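/- **Setting.** Consider the three-sorted first-order language (with equality) of the situation calculus, with sorts object, action, situation. Its symbols are: the function $do$ (action × situation → situation), the constant $S_0$, the predicate $Poss$ (action, situation), the binary predicate $\preceq$ on situations; action functions (objects → action); fluents, i.e. predicates with a tuple of object arguments and one final situation argument (the set of fluents is $\mathcal F$); object constants; and static predicates and functions, which have only object arguments (functions have object values). A *signature* is a set of these symbols, a *theory* is a set of first-order sentences, $\mathrm{sig}(\cdot)$ is the set of symbols that occur, $T\equiv T'$ is logical equivalence (over structures with nonempty domains), and $\mathrm{Cons}(T,\Delta)=\{\varphi \text{ a sentence} : T\models\varphi,\ \mathrm{sig}(\varphi)\subseteq\Delta\}$. For ground situation terms $S,S'$, $T(S'/S)$ is obtained from $T$ by replacing every occurrence of $S$ by $S'$. A formula is *uniform* in a set of situation terms if it has no quantifiers over situations, no equalities between situations, no $Poss$, no $\preceq$, and the situation argument of every fluent in it belongs to the set. A *basic action theory* is $\mathcal D=\Sigma\cup\mathcal D_{una}\cup\mathcal D_{ap}\cup\mathcal D_{ss}\cup\mathcal D_{S_0}$, where * $\Sigma$ consists of: $do(a_1,s_1)=do(a_2,s_2)\to a_1=a_2\wedge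 s_1=s_2$; $\neg(s\preceq S_0\wedge s\ne S_0)$; $s_1\preceq s_2\leftrightarrow\exists a\,(do(a,s_1)\preceq s_2)\vee s_1=s_2$; and second-order induction over situations with respect to $S_0$ and $do$; * $\mathcal D_{una}$ says that distinct object constants denote distinct objects, distinct action functions have disjoint ranges, and action functions are injective; * $\mathcal D_{ap}$ has for every action function $A$ an axiom $Poss(A(\bar x),s)\leftrightarrow\Pi_A(\bar x,s)$ with $\Pi_A$ uniform in $s$; * $\mathcal D_{ss}$ has for every fluent $F$ exactly one axiom (SSA) $\forall\bar x,a,s\,\big(F(\bar x,do(a,s))\leftrightarrow\gamma_F^+(\bar x,a,s)\vee F(\bar x,s)\wedge\neg\gamma_F^-(\bar x,a,s)\big)$, where $\gamma_F^{\pm}$ are finite (possibly empty) disjunctions of formulas $[\exists\bar y]\,(a=B(\bar t)\wedge\phi(\bar x,\bar y,s))$ with $B$ an action function, $\bar t$ object terms with variables among $\bar x,\bar y$, and $\phi$ uniform in $s$; * $\mathcal D_{S_0}$ is a first-order theory uniform in $S_0$. $\mathcal D$ is *local-effect* if in each disjunct $[\exists\bar y](a=B(\bar t)\wedge\phi)$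 of $\gamma_F^{+}$ or $\gamma_F^-$ every variable of $\bar x$ is one of the terms $\bar t$. For a theory $T$ and a signature $\Delta$, a family of theories $\{T_j\}_{j\in J}$, $|J|\ge 2$, is a *$\Delta$-decomposition* of $T$ if $\mathrm{sig}(T_i)\cap\mathrm{sig}(T_j)=\Delta$ for all $i\ne j$, $\mathrm{sig}(T_j)\neq\Delta$ for all $j$, $\bigcup_j\mathrm{sig}(T_j)=\mathrm{sig}(T)$, and $T\equiv\bigcup_jT_j$; $T$ is *$\Delta$-decomposable* into the components $T_j$ if such a family exists. Theories $T_1,T_2$ are *$\Delta$-inseparable* if $\mathrm{Cons}(T_1,\Delta)=\mathrm{Cons}(T_2,\Delta)$. **Progression.** Let $\alpha=A(\bar c)$ be a ground action, $\bar c=\langle c_1,\dots,c_k\rangle$ a tuple of object constants, and $S_\alpha=do(\alpha,S_0)$. A theory $P$ uniform in $S_\alpha$ is a *progression* of $\mathcal D_{S_0}$ with respect to $\alpha$ if for every model $M$ of $\Sigma\cup\mathcal D_{una}\cup\mathcal D_{ap}\cup\mathcal D_{ss}$: $M\models P$ iff there is a model $M'$ of $\mathcal D$ with the same objects, actions and interpretations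 of the action functions, object constants, static predicates and static functions as $M$, such that $M$ and $M'$ agree on all fluents at $S_\alpha$. For a local-effect $\mathcal D$ a specific progression is used. Instantiate $a$ by $\alpha$ in $\gamma_F^\pm$ and rewrite by the unique name axioms for actions: a disjunct $[\exists\bar y](a=B(\bar t)\wedge\phi)$ becomes $[\exists\bar y](\bar c=\bar t\wedge\phi)$ if $B=A$ and *false* if $B\ne A$ (equalities between objects are not rewritten). Let $\Omega$ be the set of the ground atoms $F(\bar d,S_0)$ such that some disjunct of $\gamma_F^+$ or $\gamma_F^-$ has the action function $A$ and its equalities $\bar c=\bar t$ contain $x_p=d_p$ for every variable $x_p$ of $\bar x$. For $\Omega'\subseteq\Omega$ let $\mathcal D_{ss}[\Omega']$ be the set of the sentences $F(\bar d,S_\alpha)\leftrightarrow\gamma_F^+(\bar d,\alpha,S_0)\vee F(\bar d,S_0)\wedge\neg\gamma_F^-(\bar d,\alpha,S_0)$, with the rewritten $\gamma_F^\pm$, for $F(\bar d,S_0)\in\Omega'$. A theory $G$ uniform in $\{S_0,S_\alpha\}$ is a result of *forgetting* $\Omega'$ in $T$ if, for every structure $M'$ in which $S_0\ne S_\alpha$,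 $M'\models G$ iff some $M\models T$ differs from $M'$ at most in the truth values of the atoms from $\Omega'$. A theory $Q$ is an *update of $T$ along $\Omega'$* if $Q\equiv G(S_0/S_\alpha)$ for some result $G$ of forgetting $\Omega'$ in $\mathcal D_{ss}[\Omega']\cup T$. Finally, $\mathcal D_{S_\alpha}$ denotes any theory uniform in $S_\alpha$ such that $\mathcal D_{S_\alpha}(S_0/S_\alpha)$ is an update of $\mathcal D_{S_0}$ along $\Omega$ (so it is determined up to logical equivalence). **Theorem (Preservation of components in local-effect basic action theories).** Let $\mathcal D$ be a local-effect basic action theory with a first-order initial theory $\mathcal D_{S_0}$. Let $\Delta_1,\Delta_2$ be signatures that contain no fluents and do not contain $do$, let $\alpha=A(\bar c)$ be as above, and put $\Delta=\Delta_1\cup\Delta_2\cup\{c_1,\dots,c_k\}$. Suppose that 1. $\mathcal D_{ss}$ is the union of theories $\{D_i\}_{i\in I}$, $I\neq\varnothing$, with $\mathrm{sig}(D_n)\cap\mathrm{sig}(D_m)\subseteq\Delta_1\cup\{do\}$ for all $n\neq m$ in $I$; 2. $\mathcal D_{S_0}$ is $\Delta_2$-decomposable into finite components $\{D'_j\}_{j\in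 J}$ uniform in $S_0$ such that $\mathrm{sig}(D'_j)\setminus\Delta\ne\varnothing$ for all $j\in J$; 3. $\mathrm{sig}(\mathcal D_{ss})\cap\mathcal F\subseteq\mathrm{sig}(\mathcal D_{S_0})$; 4. for every $i\in I$ there is $j\in J$ such that $\mathrm{sig}(D_i)\cap\mathrm{sig}(\mathcal D_{S_0})\subseteq\mathrm{sig}(D'_j)$. Then a first-order theory $\mathcal D_{S_\alpha}$ exists, and every such $\mathcal D_{S_\alpha}$ is a progression of $\mathcal D_{S_0}$ with respect to $\alpha$. Moreover, $\mathcal D_{S_\alpha}(S_0/S_\alpha)$ is $\Delta$-decomposable, up to adding a set $V$ of valid sentences (in order that the symbols required by the definition of decomposition occur): $\mathcal D_{S_\alpha}(S_0/S_\alpha)\cup V$ has a $\Delta$-decomposition $\{D''_j\}_{j\in J}$ in which, for every $j\in J$, $D''_j$ is an update of $D'_j$ along the set of those atoms of $\Omega$ whose fluents are in $\mathrm{sig}(D'_j)$. If the components $\{D'_j\}_{j\in J}$ are pairwise $\Delta$-inseparable, then so are the components $\{D''_j\}_{j\in J}$. -/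

import Mathlib

/-! # The three-sorted first-order language of the situation calculus

Sorts: object, action, situation.  Variables are de Bruijn indices, separately for each sort: an
expression indexed by `o a s` has its free variables among `o` object, `a` action and `s`
situation variables.  A quantifier binds index `0` of its sort. -/

/-- The symbols of a basic action theory other than `do`, `≼`, `S₀`, `Poss`: action functions,
fluents (the arity counts the object arguments only), object constants, static predicates and
static functions. -/
structure SCLang where
  Act : Type
  actArity : Act → ℕ
  Flu : Type
  fluArity : Flu → ℕ
  Con : Type
  Pred : Type
  predArity : Pred → ℕ
  Fn : Type
  fnArity : Fn → ℕ

/-- Non-logical symbols. -/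
inductive Symb (L : SCLang) : Type
  | doFn
  | prec
  | s0
  | poss
  | act (A : L.Act)
  | flu (F : L.Flu)
  | con (c : L.Con)
  | pred (P : L.Pred)
  | fn (f : L.Fn)

/-- Terms of sort object. -/
inductive OTerm (L : SCLang) (o : ℕ) : Type
  | var (i : Fin o)
  | con (c : L.Con)
  | fn (f : L.Fn) (ts : Fin (L.fnArity f) → OTerm L o)

/-- Terms of sort action. -/
inductive ATerm (L : SCLang) (o a : ℕ) : Type
  | var (i : Fin a)
  | fn (A : L.Act) (ts : Fin (L.actArity A) → OTerm L o)

/-- Terms of sort situation. -/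
inductive STerm (L : SCLang) (o a s : ℕ) : Type
  | var (i : Fin s)
  | s0
  | doFn (b : ATerm L o a) (t : STerm L o a s)

/-- First-order formulas. -/
inductive Fm (L : SCLang) : ℕ → ℕ → ℕ → Type
  | falsum {o a s : ℕ} : Fm L o a s
  | eqO {o a s : ℕ} (t u : OTerm L o) : Fm L o a s
  | eqA {o a s : ℕ} (t u : ATerm L o a) : Fm L o a s
  | eqS {o a s : ℕ} (t u : STerm L o a s) : Fm L o a s
  | pred {o a s : ℕ} (P : L.Pred) (ts : Fin (L.predArity P) → OTerm L o) : Fm L o a s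
  | flu {o a s : ℕ} (F : L.Flu) (ts : Fin (L.fluArity F) → OTerm L o) (t : STerm L o a s) :
      Fm L o a s
  | poss {o a s : ℕ} (b : ATerm L o a) (t : STerm L o a s) : Fm L o a s
  | prec {o a s : ℕ} (t u : STerm L o a s) : Fm L o a s
  | imp {o a s : ℕ} (φ ψ : Fm L o a s) : Fm L o a s
  | allO {o a s : ℕ} (φ : Fm L (o + 1) a s) : Fm L o a s
  | allA {o a s : ℕ} (φ : Fm L o (a + 1) s) : Fm L o a s
  | allS {o a s : ℕ} (φ : Fm L o a (s + 1)) : Fm L o a s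

abbrev Sentence (L : SCLang) : Type := Fm L 0 0 0

abbrev Theory (L : SCLang) : Type := Set (Sentence L)

namespace Fm

variable {L : SCLang} {o a s : ℕ}

def neg (φ : Fm L o a s) : Fm L o a s := imp φ falsum
def and (φ ψ : Fm L o a s) : Fm L o a s := neg (imp φ (neg ψ))
def or (φ ψ : Fm L o a s) : Fm L o a s := imp (neg φ) ψ
def iff (φ ψ : Fm L o a s) : Fm L o a s := and (imp φ ψ) (imp ψ φ)
def exO (φ : Fm L (o + 1) a s) : Fm L o a s := neg (allO (neg φ))

/-- Finite conjunction; the empty one is true. -/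
def conj (l : List (Fm L o a s)) : Fm L o a s := l.foldr and (imp falsum falsum)

/-- Finite disjunction; the empty one is false. -/
def disj (l : List (Fm L o a s)) : Fm L o a s := l.foldr or falsum

/-- Existential quantification over the object variables `0, …, m - 1`. -/
def exOs : (m : ℕ) → Fm L (o + m) a s → Fm L o a s
  | 0, φ => φ
  | m + 1, φ => exOs m (exO φ)

/-- Universal quantification over all object variables. -/
def allOs : (n : ℕ) → Fm L n a s → Fm L 0 a s
  | 0, φ => φ
  | n + 1, φ => allOs n (allO φ)

end Fm

/-! ## Signatures -/

def OTerm.sig {L : SCLang} {o : ℕ} : OTerm L o → Set (Symb L)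
  | .var _ => ∅
  | .con c => {Symb.con c}
  | .fn f ts => {Symb.fn f} ∪ ⋃ i, (ts i).sig

def ATerm.sig {L : SCLang} {o a : ℕ} : ATerm L o a → Set (Symb L)
  | .var _ => ∅
  | .fn A ts => {Symb.act A} ∪ ⋃ i, (ts i).sig

def STerm.sig {L : SCLang} {o a s : ℕ} : STerm L o a s → Set (Symb L)
  | .var _ => ∅
  | .s0 => {Symb.s0}
  | .doFn b t => {Symb.doFn} ∪ b.sig ∪ t.sig

def Fm.sig {L : SCLang} : {o a s : ℕ} → Fm L o a s → Set (Symb L)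
  | _, _, _, .falsum => ∅
  | _, _, _, .eqO t u => t.sig ∪ u.sig
  | _, _, _, .eqA t u => t.sig ∪ u.sig
  | _, _, _, .eqS t u => t.sig ∪ u.sig
  | _, _, _, .pred P ts => {Symb.pred P} ∪ ⋃ i, (ts i).sig
  | _, _, _, .flu F ts t => {Symb.flu F} ∪ (⋃ i, (ts i).sig) ∪ t.sig
  | _, _, _, .poss b t => {Symb.poss} ∪ b.sig ∪ t.sig
  | _, _, _, .prec t u => {Symb.prec} ∪ t.sig ∪ u.sig
  | _, _, _, .imp φ ψ => φ.sig ∪ ψ.sig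
  | _, _, _, .allO φ => φ.sig
  | _, _, _, .allA φ => φ.sig
  | _, _, _, .allS φ => φ.sig

/-- The symbols that occur in a theory. -/
def Theory.sig {L : SCLang} (T : Theory L) : Set (Symb L) := ⋃ φ ∈ T, Fm.sig φ

def FluentFree {L : SCLang} (Δ : Set (Symb L)) : Prop := ∀ F : L.Flu, Symb.flu F ∉ Δ

/-! ## Simultaneous substitution of terms for variables -/

def OTerm.subst {L : SCLang} {o o' : ℕ} (σ : Fin o → OTerm L o') : OTerm L o → OTerm L o'
  | .var i => σ i
  | .con c => .con c
  | .fn f ts => .fn f (fun i => (ts i).subst σ)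

def ATerm.subst {L : SCLang} {o a o' a' : ℕ} (σ : Fin o → OTerm L o') (τ : Fin a → ATerm L o' a') :
    ATerm L o a → ATerm L o' a'
  | .var i => τ i
  | .fn A ts => .fn A (fun i => (ts i).subst σ)

def STerm.subst {L : SCLang} {o a s o' a' s' : ℕ} (σ : Fin o → OTerm L o')
    (τ : Fin a → ATerm L o' a') (υ : Fin s → STerm L o' a' s') : STerm L o a s → STerm L o' a' s'
  | .var i => υ i
  | .s0 => .s0
  | .doFn b t => .doFn (b.subst σ τ) (t.subst σ τ υ)

structure TSub (L : SCLang) (o a s o' a' s' : ℕ) where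
  ob : Fin o → OTerm L o'
  ac : Fin a → ATerm L o' a'
  si : Fin s → STerm L o' a' s'

namespace TSub

variable {L : SCLang} {o a s o' a' s' : ℕ}

/-- The substitution under an object quantifier. -/
def underO (ρ : TSub L o a s o' a' s') : TSub L (o + 1) a s (o' + 1) a' s' where
  ob := Fin.cons (.var 0) (fun i => (ρ.ob i).subst (fun k => .var k.succ))
  ac := fun i => (ρ.ac i).subst (fun k => .var k.succ) .var
  si := fun i => (ρ.si i).subst (fun k => .var k.succ) .var .var

/-- The substitution under an action quantifier. -/
def underA (ρ : TSub L o a s o' a' s') : TSub L o (a + 1) s o' (a' + 1) s' where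
  ob := ρ.ob
  ac := Fin.cons (.var 0) (fun i => (ρ.ac i).subst .var (fun k => .var k.succ))
  si := fun i => (ρ.si i).subst .var (fun k => .var k.succ) .var

/-- The substitution under a situation quantifier. -/
def underS (ρ : TSub L o a s o' a' s') : TSub L o a (s + 1) o' a' (s' + 1) where
  ob := ρ.ob
  ac := ρ.ac
  si := Fin.cons (.var 0) (fun i => (ρ.si i).subst .var .var (fun k => .var k.succ))

end TSub

def Fm.subst {L : SCLang} :
    {o a s o' a' s' : ℕ} → TSub L o a s o' a' s' → Fm L o a s → Fm L o' a' s'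
  | _, _, _, _, _, _, _, .falsum => .falsum
  | _, _, _, _, _, _, ρ, .eqO t u => .eqO (t.subst ρ.ob) (u.subst ρ.ob)
  | _, _, _, _, _, _, ρ, .eqA t u => .eqA (t.subst ρ.ob ρ.ac) (u.subst ρ.ob ρ.ac)
  | _, _, _, _, _, _, ρ, .eqS t u => .eqS (t.subst ρ.ob ρ.ac ρ.si) (u.subst ρ.ob ρ.ac ρ.si)
  | _, _, _, _, _, _, ρ, .pred P ts => .pred P (fun i => (ts i).subst ρ.ob)
  | _, _, _, _, _, _, ρ, .flu F ts t =>
      .flu F (fun i => (ts i).subst ρ.ob) (t.subst ρ.ob ρ.ac ρ.si)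
  | _, _, _, _, _, _, ρ, .poss b t => .poss (b.subst ρ.ob ρ.ac) (t.subst ρ.ob ρ.ac ρ.si)
  | _, _, _, _, _, _, ρ, .prec t u => .prec (t.subst ρ.ob ρ.ac ρ.si) (u.subst ρ.ob ρ.ac ρ.si)
  | _, _, _, _, _, _, ρ, .imp φ ψ => .imp (φ.subst ρ) (ψ.subst ρ)
  | _, _, _, _, _, _, ρ, .allO φ => .allO (φ.subst ρ.underO)
  | _, _, _, _, _, _, ρ, .allA φ => .allA (φ.subst ρ.underA)
  | _, _, _, _, _, _, ρ, .allS φ => .allS (φ.subst ρ.underS)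

/-- A ground situation term, read in an arbitrary context of variables. -/
def STerm.lift {L : SCLang} {o a s : ℕ} (S : STerm L 0 0 0) : STerm L o a s :=
  S.subst Fin.elim0 Fin.elim0 Fin.elim0

/-! ## Replacement of ground situation terms: `φ(S'/S)` -/

open Classical in
/-- Replace every occurrence of the ground situation term `S` by `S'`. -/
noncomputable def STerm.replace {L : SCLang} {o a s : ℕ} (S' S : STerm L 0 0 0) :
    STerm L o a s → STerm L o a s
  | .var i => .var i
  | .s0 => if (.s0 : STerm L o a s) = S.lift then S'.lift else .s0
  | .doFn b t => if .doFn b t = S.lift then S'.lift else .doFn b (STerm.replace S' S t)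

noncomputable def Fm.replace {L : SCLang} (S' S : STerm L 0 0 0) :
    {o a s : ℕ} → Fm L o a s → Fm L o a s
  | _, _, _, .falsum => .falsum
  | _, _, _, .eqO t u => .eqO t u
  | _, _, _, .eqA t u => .eqA t u
  | _, _, _, .eqS t u => .eqS (STerm.replace S' S t) (STerm.replace S' S u)
  | _, _, _, .pred P ts => .pred P ts
  | _, _, _, .flu F ts t => .flu F ts (STerm.replace S' S t)
  | _, _, _, .poss b t => .poss b (STerm.replace S' S t)
  | _, _, _, .prec t u => .prec (STerm.replace S' S t) (STerm.replace S' S u)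
  | _, _, _, .imp φ ψ => .imp (Fm.replace S' S φ) (Fm.replace S' S ψ)
  | _, _, _, .allO φ => .allO (Fm.replace S' S φ)
  | _, _, _, .allA φ => .allA (Fm.replace S' S φ)
  | _, _, _, .allS φ => .allS (Fm.replace S' S φ)

/-- `T(S'/S)`. -/
noncomputable def Theory.replace {L : SCLang} (S' S : STerm L 0 0 0) (T : Theory L) : Theory L :=
  Fm.replace S' S '' T

/-! ## Uniform formulas -/

/-- No quantifiers over situations, no equalities between situations, no `Poss`, no `≼`, and the
situation argument of every fluent satisfies `U`. -/
def Fm.Uniform {L : SCLang} :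
    {o a s : ℕ} → (∀ o a : ℕ, STerm L o a s → Prop) → Fm L o a s → Prop
  | _, _, _, _, .falsum => True
  | _, _, _, _, .eqO _ _ => True
  | _, _, _, _, .eqA _ _ => True
  | _, _, _, _, .eqS _ _ => False
  | _, _, _, _, .pred _ _ => True
  | _, _, _, U, .flu _ _ t => U _ _ t
  | _, _, _, _, .poss _ _ => False
  | _, _, _, _, .prec _ _ => False
  | _, _, _, U, .imp φ ψ => φ.Uniform U ∧ ψ.Uniform U
  | _, _, _, U, .allO φ => φ.Uniform U
  | _, _, _, U, .allA φ => φ.Uniform U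
  | _, _, _, _, .allS _ => False

/-- Uniform in the only situation variable of the context. -/
def Fm.UniformInVar {L : SCLang} {o a : ℕ} (φ : Fm L o a 1) : Prop :=
  φ.Uniform (fun _ _ t => t = .var 0)

/-- A theory uniform in a ground situation term. -/
def Theory.UniformIn {L : SCLang} (S : STerm L 0 0 0) (T : Theory L) : Prop :=
  ∀ φ ∈ T, Fm.Uniform (fun _ _ t => t = S.lift) φ

/-- The same with two ground situation terms allowed as situation arguments of fluents. -/
def Theory.UniformIn₂ {L : SCLang} (S S' : STerm L 0 0 0) (T : Theory L) : Prop :=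
  ∀ φ ∈ T, Fm.Uniform (fun _ _ t => t = S.lift ∨ t = S'.lift) φ

/-! ## Semantics -/

/-- Structures with given domains of objects, actions and situations. -/
structure SCStr (L : SCLang) (Ob Ac Si : Type) where
  act : (A : L.Act) → (Fin (L.actArity A) → Ob) → Ac
  con : L.Con → Ob
  fn : (f : L.Fn) → (Fin (L.fnArity f) → Ob) → Ob
  pred : (P : L.Pred) → (Fin (L.predArity P) → Ob) → Prop
  flu : (F : L.Flu) → (Fin (L.fluArity F) → Ob) → Si → Prop
  s0 : Si
  doFn : Ac → Si → Si
  poss : Ac → Si → Prop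
  prec : Si → Si → Prop

section Semantics

variable {L : SCLang} {Ob Ac Si : Type}

def OTerm.eval {o : ℕ} (M : SCStr L Ob Ac Si) (v : Fin o → Ob) : OTerm L o → Ob
  | .var i => v i
  | .con c => M.con c
  | .fn f ts => M.fn f (fun i => (ts i).eval M v)

def ATerm.eval {o a : ℕ} (M : SCStr L Ob Ac Si) (v : Fin o → Ob) (w : Fin a → Ac) :
    ATerm L o a → Ac
  | .var i => w i
  | .fn A ts => M.act A (fun i => (ts i).eval M v)

def STerm.eval {o a s : ℕ} (M : SCStr L Ob Ac Si) (v : Fin o → Ob) (w : Fin a → Ac)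
    (x : Fin s → Si) : STerm L o a s → Si
  | .var i => x i
  | .s0 => M.s0
  | .doFn b t => M.doFn (b.eval M v w) (t.eval M v w x)

def Fm.Realize (M : SCStr L Ob Ac Si) :
    {o a s : ℕ} → (Fin o → Ob) → (Fin a → Ac) → (Fin s → Si) → Fm L o a s → Prop
  | _, _, _, _, _, _, .falsum => False
  | _, _, _, v, _, _, .eqO t u => t.eval M v = u.eval M v
  | _, _, _, v, w, _, .eqA t u => t.eval M v w = u.eval M v w
  | _, _, _, v, w, x, .eqS t u => t.eval M v w x = u.eval M v w x
  | _, _, _, v, _, _, .pred P ts => M.pred P (fun i => (ts i).eval M v)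
  | _, _, _, v, w, x, .flu F ts t => M.flu F (fun i => (ts i).eval M v) (t.eval M v w x)
  | _, _, _, v, w, x, .poss b t => M.poss (b.eval M v w) (t.eval M v w x)
  | _, _, _, v, w, x, .prec t u => M.prec (t.eval M v w x) (u.eval M v w x)
  | _, _, _, v, w, x, .imp φ ψ => φ.Realize M v w x → ψ.Realize M v w x
  | _, _, _, v, w, x, .allO φ => ∀ d : Ob, φ.Realize M (Fin.cons d v) w x
  | _, _, _, v, w, x, .allA φ => ∀ d : Ac, φ.Realize M v (Fin.cons d w) x
  | _, _, _, v, w, x, .allS φ => ∀ d : Si, φ.Realize M v w (Fin.cons d x)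

def SCStr.Models (M : SCStr L Ob Ac Si) (T : Theory L) : Prop :=
  ∀ φ ∈ T, Fm.Realize M Fin.elim0 Fin.elim0 Fin.elim0 φ

/-- The value of a ground situation term. -/
def SCStr.sit (M : SCStr L Ob Ac Si) (S : STerm L 0 0 0) : Si :=
  S.eval M Fin.elim0 Fin.elim0 Fin.elim0

end Semantics

/-- `T ⊨ φ`, over structures with nonempty domains. -/
def Theory.Entails {L : SCLang} (T : Theory L) (φ : Sentence L) : Prop :=
  ∀ (Ob Ac Si : Type) [Nonempty Ob] [Nonempty Ac] [Nonempty Si] (M : SCStr L Ob Ac Si),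
    M.Models T → Fm.Realize M Fin.elim0 Fin.elim0 Fin.elim0 φ

/-- Logical equivalence of theories. -/
def Theory.Equiv {L : SCLang} (T T' : Theory L) : Prop :=
  ∀ (Ob Ac Si : Type) [Nonempty Ob] [Nonempty Ac] [Nonempty Si] (M : SCStr L Ob Ac Si),
    M.Models T ↔ M.Models T'

/-- Logical validity. -/
def Sentence.Valid {L : SCLang} (φ : Sentence L) : Prop := Theory.Entails ∅ φ

/-- `Cons(T, Δ)`. -/
def Theory.Cons {L : SCLang} (T : Theory L) (Δ : Set (Symb L)) : Set (Sentence L) :=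
  {φ | T.Entails φ ∧ Fm.sig φ ⊆ Δ}

/-- `Δ`-inseparability. -/
def DeltaInseparable {L : SCLang} (Δ : Set (Symb L)) (T₁ T₂ : Theory L) : Prop :=
  T₁.Cons Δ = T₂.Cons Δ

/-- `{D j}` is a `Δ`-decomposition of `T` (into at least two components). -/
structure IsDecomposition {L : SCLang} {J : Type*} (Δ : Set (Symb L)) (T : Theory L)
    (D : J → Theory L) : Prop where
  nontrivial : Nontrivial J
  inter : ∀ i j, i ≠ j → (D i).sig ∩ (D j).sig = Δ
  proper : ∀ j, (D j).sig ≠ Δ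
  union : ⋃ j, (D j).sig = T.sig
  equiv : T.Equiv (⋃ j, D j)

/-! ## Basic action theories -/

/-- A disjunct `[∃ ȳ] (a = A(t̄) ∧ φ(x̄, ȳ, s))` of `γ⁺` or `γ⁻` in the successor state axiom of a
fluent with `n` object variables `x̄`.  There are `bnd` variables `ȳ`: they have the indices
`0, …, bnd - 1`, and the `p`-th of the variables `x̄` has the index `p + bnd`. -/
structure Effect (L : SCLang) (n : ℕ) where
  bnd : ℕ
  act : L.Act
  arg : Fin (L.actArity act) → OTerm L (n + bnd)
  ctx : Fm L (n + bnd) 0 1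
  ctx_uniform : ctx.UniformInVar

/-- The right-hand side of a successor state axiom: the disjuncts of `γ⁺` and of `γ⁻`. -/
structure SSA (L : SCLang) (n : ℕ) where
  pos : List (Effect L n)
  neg : List (Effect L n)

/-- The data of a basic action theory: the initial theory (uniform in `S₀`), the right-hand sides
`Π_A(x̄, s)` of the precondition axioms (uniform in `s`) and the successor state axioms. -/
structure BAT (L : SCLang) where
  init : Theory L
  init_uniform : init.UniformIn .s0
  pre : (A : L.Act) → Fm L (L.actArity A) 0 1
  pre_uniform : ∀ A, (pre A).UniformInVar
  ssa : (F : L.Flu) → SSA L (L.fluArity F)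

/-- `[∃ ȳ] (a = A(t̄) ∧ φ(x̄, ȳ, s))` as a formula in `x̄, a, s`. -/
def Effect.toFm {L : SCLang} {n : ℕ} (e : Effect L n) : Fm L n 1 1 :=
  Fm.exOs e.bnd
    ((Fm.eqA (.var 0) (.fn e.act e.arg)).and (e.ctx.subst ⟨.var, Fin.elim0, .var⟩))

namespace BAT

variable {L : SCLang} (D : BAT L)

/-- The successor state axiom
`∀ x̄ a s, F(x̄, do(a, s)) ↔ γ⁺(x̄, a, s) ∨ F(x̄, s) ∧ ¬ γ⁻(x̄, a, s)`. -/
def ssaSentence (F : L.Flu) : Sentence L :=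
  .allS (.allA (.allOs (L.fluArity F)
    ((Fm.flu F .var (.doFn (.var 0) (.var 0))).iff
      ((Fm.disj ((D.ssa F).pos.map Effect.toFm)).or
        ((Fm.flu F .var (.var 0)).and (Fm.disj ((D.ssa F).neg.map Effect.toFm)).neg)))))

/-- The theory `D_ss`. -/
def ssaTheory : Theory L := Set.range D.ssaSentence

/-- Local-effect: the arguments of every action function in active position of the successor state
axiom of a fluent contain all the object variables of the fluent. -/
def LocalEffect : Prop :=
  ∀ F : L.Flu, ∀ e ∈ (D.ssa F).pos ++ (D.ssa F).neg, ∀ p : Fin (L.fluArity F),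
    ∃ q, e.arg q = .var (p.addNat e.bnd)

end BAT

section Models

variable {L : SCLang} {Ob Ac Si : Type} (M : SCStr L Ob Ac Si)

/-- The foundational axioms `Σ` (with second-order induction). -/
structure SCStr.Foundational : Prop where
  do_inj : ∀ a₁ a₂ s₁ s₂, M.doFn a₁ s₁ = M.doFn a₂ s₂ → a₁ = a₂ ∧ s₁ = s₂
  initial : ∀ s, ¬ (M.prec s M.s0 ∧ s ≠ M.s0)
  prec_iff : ∀ s₁ s₂, M.prec s₁ s₂ ↔ (∃ a, M.prec (M.doFn a s₁) s₂) ∨ s₁ = s₂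
  induction : ∀ P : Si → Prop, P M.s0 → (∀ a s, P s → P (M.doFn a s)) → ∀ s, P s

/-- The unique name axioms `D_una`. -/
structure SCStr.UniqueNames : Prop where
  con_inj : ∀ c d, c ≠ d → M.con c ≠ M.con d
  act_ne : ∀ A B, A ≠ B → ∀ x y, M.act A x ≠ M.act B y
  act_inj : ∀ A x y, M.act A x = M.act A y → x = y

/-- The precondition axioms `D_ap`: `∀ x̄ s, Poss(A(x̄), s) ↔ Π_A(x̄, s)`. -/
def SCStr.Preconditions (D : BAT L) : Prop :=
  ∀ A x s, M.poss (M.act A x) s ↔ (D.pre A).Realize M x Fin.elim0 (fun _ => s)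

/-- `M` is a model of `Σ ∪ D_una ∪ D_ap ∪ D_ss`. -/
structure SCStr.ModelsDynamics (D : BAT L) : Prop where
  foundational : M.Foundational
  uniqueNames : M.UniqueNames
  preconditions : M.Preconditions D
  ssa : M.Models D.ssaTheory

/-- `M` is a model of the basic action theory
`Σ ∪ D_una ∪ D_ap ∪ D_ss ∪ D_{S₀}`. -/
def SCStr.ModelsBAT (D : BAT L) : Prop := M.ModelsDynamics D ∧ M.Models D.init

end Models

/-! ## Progression -/

/-- A ground action `A(c̄)`, with `c̄` a tuple of object constants. -/
structure GroundAction (L : SCLang) where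
  act : L.Act
  arg : Fin (L.actArity act) → L.Con

namespace GroundAction

variable {L : SCLang} (α : GroundAction L)

/-- The situation term `S_α = do(α, S₀)`. -/
def sit : STerm L 0 0 0 := .doFn (.fn α.act (fun q => .con (α.arg q))) .s0

/-- The constants `c₁, …, c_k`, as a signature. -/
def constants : Set (Symb L) := Set.range (fun q => Symb.con (α.arg q))

/-- The `q`-th argument of `α`, for an action function `B` equal to that of `α`. -/
def argOf {B : L.Act} (h : α.act = B) (q : Fin (L.actArity B)) : L.Con :=
  α.arg (Fin.cast (congrArg L.actArity h.symm) q)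

end GroundAction

/-- `M ∼_{S_α} M'`: the same objects, actions and situation-independent symbols, and the same
fluents at `S_α`. -/
structure SCStr.SimAt {L : SCLang} {Ob Ac Si Si' : Type} (α : GroundAction L)
    (M : SCStr L Ob Ac Si) (M' : SCStr L Ob Ac Si') : Prop where
  act : M.act = M'.act
  con : M.con = M'.con
  fn : M.fn = M'.fn
  pred : M.pred = M'.pred
  flu : ∀ F v, M.flu F v (M.sit α.sit) ↔ M'.flu F v (M'.sit α.sit)

/-- `P` is a progression of the initial theory of `D` with respect to `α`, model-theoretically. -/
structure BAT.IsProgression {L : SCLang} (D : BAT L) (α : GroundAction L) (P : Theory L) :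
    Prop where
  uniform : P.UniformIn α.sit
  models_iff : ∀ (Ob Ac Si : Type) [Nonempty Ob] [Nonempty Ac] [Nonempty Si]
    (M : SCStr L Ob Ac Si), M.ModelsDynamics D →
      (M.Models P ↔ ∃ (Si' : Type) (M' : SCStr L Ob Ac Si'), M'.ModelsBAT D ∧ M.SimAt α M')

/-- The ground atom `F(t̄, S₀)`, with `t̄` a tuple of object constants. -/
structure GAtom (L : SCLang) where
  flu : L.Flu
  arg : Fin (L.fluArity flu) → L.Con

/-- `M ∼_Ω M'` for a set `Ω` of ground atoms `F(t̄, S₀)`: the structures differ at most in the truth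
values of the atoms from `Ω`. -/
structure SCStr.SimOff {L : SCLang} {Ob Ac Si : Type} (Ω : Set (GAtom L))
    (M M' : SCStr L Ob Ac Si) : Prop where
  act : M.act = M'.act
  con : M.con = M'.con
  fn : M.fn = M'.fn
  pred : M.pred = M'.pred
  s0 : M.s0 = M'.s0
  doFn : M.doFn = M'.doFn
  poss : M.poss = M'.poss
  prec : M.prec = M'.prec
  flu : ∀ F v s, (¬ ∃ t, (⟨F, t⟩ : GAtom L) ∈ Ω ∧ v = (fun p => M.con (t p)) ∧ s = M.s0) →
    (M.flu F v s ↔ M'.flu F v s)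

/-- `G` is a result of forgetting `Ω` in `T`.  The atoms at `S₀` and at `S_α` are different atoms:
only structures in which the two situations are distinct are considered. -/
def IsForget {L : SCLang} (α : GroundAction L) (T : Theory L) (Ω : Set (GAtom L))
    (G : Theory L) : Prop :=
  ∀ (Ob Ac Si : Type) [Nonempty Ob] [Nonempty Ac] [Nonempty Si] (M' : SCStr L Ob Ac Si),
    M'.s0 ≠ M'.sit α.sit →
      (M'.Models G ↔ ∃ M : SCStr L Ob Ac Si, M.Models T ∧ M.SimOff Ω M')

open Classical in
/-- A disjunct `[∃ ȳ] (a = B(t̄) ∧ φ)` with `a` instantiated by `α = A(c̄)` and rewritten by the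
unique name axioms for actions: `[∃ ȳ] (c̄ = t̄ ∧ φ)` if `B` is `A`, and false otherwise. -/
noncomputable def Effect.inst {L : SCLang} {n : ℕ} (α : GroundAction L) (e : Effect L n) :
    Fm L n 0 1 :=
  if h : α.act = e.act then
    Fm.exOs e.bnd
      ((Fm.conj (List.ofFn fun q => Fm.eqO (.con (α.argOf h q)) (e.arg q))).and e.ctx)
  else .falsum

namespace BAT

variable {L : SCLang} (D : BAT L) (α : GroundAction L)

/-- The set `Ω(S₀)` of atoms `F(t̄, S₀)` such that `x̄ = t̄` appears in the successor state axiom of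
`F` instantiated with `α`: some disjunct of `γ⁺` or `γ⁻` has the action function of `α`, and equates
every object variable of `F` with the corresponding constant from `t̄`. -/
def omega : Set (GAtom L) :=
  {g | ∃ e ∈ (D.ssa g.flu).pos ++ (D.ssa g.flu).neg, ∃ h : α.act = e.act,
    ∀ p, ∃ q, e.arg q = .var (p.addNat e.bnd) ∧ g.arg p = α.argOf h q}

/-- `F(t̄, S_α) ↔ γ⁺(t̄, α, S₀) ∨ F(t̄, S₀) ∧ ¬ γ⁻(t̄, α, S₀)`, for the instantiated and rewritten
`γ⁺`, `γ⁻`. -/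
noncomputable def instSentence (g : GAtom L) : Sentence L :=
  (Fm.flu g.flu (fun p => .con (g.arg p)) α.sit).iff
    (((Fm.disj ((D.ssa g.flu).pos.map (Effect.inst α))).subst
        ⟨fun p => .con (g.arg p), Fin.elim0, fun _ => .s0⟩).or
      ((Fm.flu g.flu (fun p => .con (g.arg p)) .s0).and
        ((Fm.disj ((D.ssa g.flu).neg.map (Effect.inst α))).subst
          ⟨fun p => .con (g.arg p), Fin.elim0, fun _ => .s0⟩).neg))

/-- The instantiation `D_ss[Ω]`. -/
noncomputable def inst (Ω : Set (GAtom L)) : Theory L := D.instSentence α '' Ω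

/-- `Q` is logically equivalent to `forget(D_ss[Ω] ∪ T, Ω)(S₀/S_α)`. -/
def IsUpdate (T : Theory L) (Ω : Set (GAtom L)) (Q : Theory L) : Prop :=
  ∃ G : Theory L, G.UniformIn₂ .s0 α.sit ∧ IsForget α (D.inst α Ω ∪ T) Ω G ∧
    Q.Equiv (G.replace .s0 α.sit)

/-- `P` is (up to logical equivalence) the progression `D_{S_α}` of a local-effect theory, the one
obtained by forgetting `Ω(S₀)` in `D_ss[Ω(S₀)] ∪ D_{S₀}`. -/
structure IsLocalEffectProgression (P : Theory L) : Prop where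
  uniform : P.UniformIn α.sit
  update : D.IsUpdate α D.init (D.omega α) (P.replace .s0 α.sit)

end BAT

/-! An update has a purely semantic description (`BAT.IsUpdate.models_iff`): a structure satisfies
it iff its state at S₀ arises from some state f satisfying the old theory by recomputing the atoms
of Ω through the successor state axioms and leaving all other atoms alone. The progression and
inseparability claims are read off from this description.

Progression. By local effect, a disjunct that fires under α fixes every argument of its fluent to a
constant of α. Under unique names, recomputing just the atoms of Ω therefore yields the full
successor state (`BAT.LocalEffect.updated_iff`). A model of the basic action theory supplies f as
its initial state. Conversely, any f satisfying the initial theory is the root of a tree of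
situations that models the whole theory (`BAT.treeModel_modelsDynamics`).

Components. Condition 3 and the absence of fluents in Δ₂ assign each fluent to exactly one component
of the initial theory, and alignment forces the initial-theory symbols of its successor state axiom
into the same component. So D_ss[Ω] ∪ D_{S₀} splits into pieces with disjoint sets of fluents, and
forgetting can be done piecewise (`IsForget.iUnion`). Within a piece only finitely many atoms are
forgotten, from finitely many sentences, so the result is explicit: repeatedly replace φ by φ[g :=
true] ∨ φ[g := false] (`exists_isForget`). This introduces no symbols besides constants of α. Hence
two new components share only symbols from Δ₁, Δ₂ and c̄; valid sentences pad the signatures to the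
exact equalities in the definition of decomposition.

Inseparability. Every state satisfying a component has an updated state over the same static part,
and every model of the update comes from such a state. Sentences without fluents cannot distinguish
the two, so the Δ-consequences of each component do not change (`BAT.IsUpdate.cons_eq`). -/

section

variable {L : SCLang} {Ob Ac Si Si' : Type}

/-! ## Semantics of substitution and of the derived connectives -/

/-- The same objects, actions and situation-independent symbols. -/
structure SCStr.SameStatic (M : SCStr L Ob Ac Si) (N : SCStr L Ob Ac Si') : Prop where
  act : M.act = N.act
  con : M.con = N.con
  fn : M.fn = N.fn
  pred : M.pred = N.pred

theorem OTerm.eval_congr {M : SCStr L Ob Ac Si} {N : SCStr L Ob Ac Si'} (h : M.SameStatic N)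
    {o : ℕ} (v : Fin o → Ob) (t : OTerm L o) : t.eval M v = t.eval N v := by
  induction t with
  | var i => rfl
  | con c => exact congrFun h.con c
  | fn f ts ih => simp only [OTerm.eval, h.fn, ih]

theorem ATerm.eval_congr {M : SCStr L Ob Ac Si} {N : SCStr L Ob Ac Si'} (h : M.SameStatic N)
    {o a : ℕ} (v : Fin o → Ob) (w : Fin a → Ac) (t : ATerm L o a) :
    t.eval M v w = t.eval N v w := by
  cases t with
  | var i => rfl
  | fn A ts => simp only [ATerm.eval, h.act, OTerm.eval_congr h]

theorem OTerm.eval_subst (M : SCStr L Ob Ac Si) {o o' : ℕ} (σ : Fin o → OTerm L o')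
    (v : Fin o' → Ob) (t : OTerm L o) :
    (t.subst σ).eval M v = t.eval M (fun i => (σ i).eval M v) := by
  induction t with
  | var i => rfl
  | con c => rfl
  | fn f ts ih => simp only [OTerm.subst, OTerm.eval, ih]

theorem ATerm.eval_subst (M : SCStr L Ob Ac Si) {o a o' a' : ℕ} (σ : Fin o → OTerm L o')
    (τ : Fin a → ATerm L o' a') (v : Fin o' → Ob) (w : Fin a' → Ac) (t : ATerm L o a) :
    (t.subst σ τ).eval M v w =
      t.eval M (fun i => (σ i).eval M v) (fun i => (τ i).eval M v w) := by
  cases t with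
  | var i => rfl
  | fn A ts => simp only [ATerm.subst, ATerm.eval, OTerm.eval_subst]

theorem STerm.eval_subst (M : SCStr L Ob Ac Si) {o a s o' a' s' : ℕ} (σ : Fin o → OTerm L o')
    (τ : Fin a → ATerm L o' a') (υ : Fin s → STerm L o' a' s') (v : Fin o' → Ob)
    (w : Fin a' → Ac) (x : Fin s' → Si) (t : STerm L o a s) :
    (t.subst σ τ υ).eval M v w x =
      t.eval M (fun i => (σ i).eval M v) (fun i => (τ i).eval M v w)
        (fun i => (υ i).eval M v w x) := by
  induction t with
  | var i => rfl
  | s0 => rfl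
  | doFn b t ih => simp only [STerm.subst, STerm.eval, ATerm.eval_subst, ih]

theorem STerm.eval_lift (M : SCStr L Ob Ac Si) {o a s : ℕ} (S : STerm L 0 0 0) (v : Fin o → Ob)
    (w : Fin a → Ac) (x : Fin s → Si) : (S.lift : STerm L o a s).eval M v w x = M.sit S := by
  rw [STerm.lift, STerm.eval_subst, SCStr.sit]
  congr 1 <;> exact Subsingleton.elim _ _

theorem Fm.realize_subst (M : SCStr L Ob Ac Si) {o a s : ℕ} (φ : Fm L o a s) :
    ∀ {o' a' s' : ℕ} (ρ : TSub L o a s o' a' s') (v' : Fin o' → Ob) (w' : Fin a' → Ac)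
      (x' : Fin s' → Si) (v : Fin o → Ob) (w : Fin a → Ac) (x : Fin s → Si),
      (∀ i, (ρ.ob i).eval M v' = v i) → (∀ i, (ρ.ac i).eval M v' w' = w i) →
      (∀ i, (ρ.si i).eval M v' w' x' = x i) →
      ((φ.subst ρ).Realize M v' w' x' ↔ φ.Realize M v w x) := by
  induction φ with
  | falsum => intros; rfl
  | eqO t u =>
    intro o' a' s' ρ v' w' x' v w x h₁ h₂ h₃
    simp only [Fm.subst, Fm.Realize, OTerm.eval_subst, h₁]
  | eqA t u =>
    intro o' a' s' ρ v' w' x' v w x h₁ h₂ h₃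
    simp only [Fm.subst, Fm.Realize, ATerm.eval_subst, h₁, h₂]
  | eqS t u =>
    intro o' a' s' ρ v' w' x' v w x h₁ h₂ h₃
    simp only [Fm.subst, Fm.Realize, STerm.eval_subst, h₁, h₂, h₃]
  | pred P ts =>
    intro o' a' s' ρ v' w' x' v w x h₁ h₂ h₃
    simp only [Fm.subst, Fm.Realize, OTerm.eval_subst, h₁]
  | flu F ts t =>
    intro o' a' s' ρ v' w' x' v w x h₁ h₂ h₃
    simp only [Fm.subst, Fm.Realize, OTerm.eval_subst, STerm.eval_subst, h₁, h₂, h₃]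
  | poss b t =>
    intro o' a' s' ρ v' w' x' v w x h₁ h₂ h₃
    simp only [Fm.subst, Fm.Realize, ATerm.eval_subst, STerm.eval_subst, h₁, h₂, h₃]
  | prec t u =>
    intro o' a' s' ρ v' w' x' v w x h₁ h₂ h₃
    simp only [Fm.subst, Fm.Realize, STerm.eval_subst, h₁, h₂, h₃]
  | imp φ ψ ih₁ ih₂ =>
    intro o' a' s' ρ v' w' x' v w x h₁ h₂ h₃
    exact imp_congr (ih₁ ρ _ _ _ _ _ _ h₁ h₂ h₃) (ih₂ ρ _ _ _ _ _ _ h₁ h₂ h₃)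
  | allO φ ih =>
    intro o' a' s' ρ v' w' x' v w x h₁ h₂ h₃
    refine forall_congr' fun d => ih ρ.underO _ _ _ _ _ _ (fun i => ?_) (fun i => ?_) fun i => ?_
    · refine Fin.cases rfl (fun i => ?_) i
      exact (OTerm.eval_subst ..).trans (h₁ i)
    · exact (ATerm.eval_subst ..).trans (h₂ i)
    · exact (STerm.eval_subst ..).trans (h₃ i)
  | allA φ ih =>
    intro o' a' s' ρ v' w' x' v w x h₁ h₂ h₃
    refine forall_congr' fun d => ih ρ.underA _ _ _ _ _ _ (fun i => ?_) (fun i => ?_) fun i => ?_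
    · exact h₁ i
    · refine Fin.cases rfl (fun i => ?_) i
      exact (ATerm.eval_subst ..).trans (h₂ i)
    · exact (STerm.eval_subst ..).trans (h₃ i)
  | allS φ ih =>
    intro o' a' s' ρ v' w' x' v w x h₁ h₂ h₃
    refine forall_congr' fun d => ih ρ.underS _ _ _ _ _ _ (fun i => ?_) (fun i => ?_) fun i => ?_
    · exact h₁ i
    · exact h₂ i
    · refine Fin.cases rfl (fun i => ?_) i
      exact (STerm.eval_subst ..).trans (h₃ i)

section Connectives

variable (M : SCStr L Ob Ac Si) {o a s : ℕ} (v : Fin o → Ob) (w : Fin a → Ac) (x : Fin s → Si)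

@[simp] theorem Fm.realize_neg (φ : Fm L o a s) :
    φ.neg.Realize M v w x ↔ ¬ φ.Realize M v w x := Iff.rfl

@[simp] theorem Fm.realize_and (φ ψ : Fm L o a s) :
    (φ.and ψ).Realize M v w x ↔ φ.Realize M v w x ∧ ψ.Realize M v w x := by
  simp [Fm.and, Fm.Realize]

@[simp] theorem Fm.realize_or (φ ψ : Fm L o a s) :
    (φ.or ψ).Realize M v w x ↔ φ.Realize M v w x ∨ ψ.Realize M v w x := by
  simp [Fm.or, Fm.Realize]
  tauto

@[simp] theorem Fm.realize_iff (φ ψ : Fm L o a s) :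
    (φ.iff ψ).Realize M v w x ↔ (φ.Realize M v w x ↔ ψ.Realize M v w x) := by
  simp [Fm.iff, Fm.Realize]
  tauto

@[simp] theorem Fm.realize_conj (l : List (Fm L o a s)) :
    (Fm.conj l).Realize M v w x ↔ ∀ φ ∈ l, φ.Realize M v w x := by
  induction l with
  | nil => simp [Fm.conj, Fm.Realize]
  | cons φ l ih =>
    rw [List.forall_mem_cons, ← ih]
    exact Fm.realize_and M v w x φ (Fm.conj l)

@[simp] theorem Fm.realize_disj (l : List (Fm L o a s)) :
    (Fm.disj l).Realize M v w x ↔ ∃ φ ∈ l, φ.Realize M v w x := by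
  induction l with
  | nil => simp [Fm.disj, Fm.Realize]
  | cons φ l ih =>
    simp only [List.mem_cons, exists_eq_or_imp, ← ih]
    exact Fm.realize_or M v w x φ (Fm.disj l)

theorem Fm.realize_exO (φ : Fm L (o + 1) a s) :
    φ.exO.Realize M v w x ↔ ∃ d, φ.Realize M (Fin.cons d v) w x := by
  simp [Fm.exO, Fm.Realize]

theorem Fm.realize_exOs (m : ℕ) (φ : Fm L (o + m) a s) :
    (Fm.exOs m φ).Realize M v w x ↔
      ∃ u : Fin (o + m) → Ob, (∀ p : Fin o, u (p.addNat m) = v p) ∧ φ.Realize M u w x := by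
  induction m with
  | zero =>
    refine ⟨fun h => ⟨v, fun p => rfl, h⟩, fun ⟨u, hu, h⟩ => ?_⟩
    obtain rfl : u = v := funext hu
    exact h
  | succ m ih =>
    rw [Fm.exOs, ih]
    constructor
    · rintro ⟨u, hu, h⟩
      obtain ⟨d, h⟩ := (Fm.realize_exO M u w x φ).1 h
      exact ⟨Fin.cons d u, hu, h⟩
    · rintro ⟨u, hu, h⟩
      refine ⟨fun i => u i.succ, hu, (Fm.realize_exO M _ w x φ).2 ⟨u 0, ?_⟩⟩
      rwa [show (Fin.cons (u 0) fun i => u i.succ : Fin (o + m + 1) → Ob) = u from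
        Fin.cons_self_tail u]

theorem Fm.realize_allOs {n : ℕ} (v : Fin 0 → Ob) (φ : Fm L n a s) :
    (Fm.allOs n φ).Realize M v w x ↔ ∀ u : Fin n → Ob, φ.Realize M u w x := by
  induction n with
  | zero => exact ⟨fun h u => by rwa [Subsingleton.elim u v], fun h => h v⟩
  | succ n ih =>
    rw [Fm.allOs, ih]
    refine ⟨fun h u => ?_, fun h u d => h _⟩
    have := h (fun i => u i.succ) (u 0)
    rwa [show (Fin.cons (u 0) fun i => u i.succ : Fin (n + 1) → Ob) = u from
      Fin.cons_self_tail u] at this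

end Connectives

/-! ## Uniform formulas: dependence on the fluents and replacement of situation terms -/

/-- A uniform formula touches situations only through the fluents at its allowed situation terms.
The two situation domains may thus be unrelated, which permits comparison with two-point structures
and trees. -/
theorem Fm.realize_congr_of_uniform {M : SCStr L Ob Ac Si} {N : SCStr L Ob Ac Si'}
    (h : M.SameStatic N) {o a s : ℕ} (φ : Fm L o a s) :
    ∀ (U : ∀ o a : ℕ, STerm L o a s → Prop) (x : Fin s → Si) (y : Fin s → Si'),
      φ.Uniform U → (∀ o a t, U o a t → ∀ F v w u,
        M.flu F u (t.eval M v w x) ↔ N.flu F u (t.eval N v w y)) →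
      ∀ v w, φ.Realize M v w x ↔ φ.Realize N v w y := by
  induction φ with
  | falsum => intros; rfl
  | eqO t u => intros; simp only [Fm.Realize, OTerm.eval_congr h]
  | eqA t u => intros; simp only [Fm.Realize, ATerm.eval_congr h]
  | eqS t u => intro U x y hU; exact hU.elim
  | pred P ts => intros; simp only [Fm.Realize, OTerm.eval_congr h, h.pred]
  | flu F ts t =>
    intro U x y hU H v w
    simp only [Fm.Realize, OTerm.eval_congr h]
    exact H _ _ t hU F v w _
  | poss b t => intro U x y hU; exact hU.elim
  | prec t u => intro U x y hU; exact hU.elim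
  | imp φ ψ ih₁ ih₂ =>
    intro U x y hU H v w
    exact imp_congr (ih₁ U x y hU.1 H v w) (ih₂ U x y hU.2 H v w)
  | allO φ ih =>
    intro U x y hU H v w
    exact forall_congr' fun d => ih U x y hU H _ w
  | allA φ ih =>
    intro U x y hU H v w
    exact forall_congr' fun d => ih U x y hU H v _
  | allS φ ih => intro U x y hU; exact hU.elim

/-- A syntactic replacement of situation terms is traded for a change of structure: the fluents of
`N` at the original term are those of `M` at the replaced one. -/
theorem Fm.realize_replace {M : SCStr L Ob Ac Si} {N : SCStr L Ob Ac Si'} (h : M.SameStatic N)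
    (S' S : STerm L 0 0 0) {o a s : ℕ} (φ : Fm L o a s) :
    ∀ (U : ∀ o a : ℕ, STerm L o a s → Prop) (x : Fin s → Si) (y : Fin s → Si'),
      φ.Uniform U → (∀ o a t, U o a t → ∀ F v w u,
        M.flu F u ((STerm.replace S' S t).eval M v w x) ↔ N.flu F u (t.eval N v w y)) →
      ∀ v w, (φ.replace S' S).Realize M v w x ↔ φ.Realize N v w y := by
  induction φ with
  | falsum => intros; rfl
  | eqO t u => intros; simp only [Fm.replace, Fm.Realize, OTerm.eval_congr h]
  | eqA t u => intros; simp only [Fm.replace, Fm.Realize, ATerm.eval_congr h]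
  | eqS t u => intro U x y hU; exact hU.elim
  | pred P ts => intros; simp only [Fm.replace, Fm.Realize, OTerm.eval_congr h, h.pred]
  | flu F ts t =>
    intro U x y hU H v w
    simp only [Fm.replace, Fm.Realize, OTerm.eval_congr h]
    exact H _ _ t hU F v w _
  | poss b t => intro U x y hU; exact hU.elim
  | prec t u => intro U x y hU; exact hU.elim
  | imp φ ψ ih₁ ih₂ =>
    intro U x y hU H v w
    exact imp_congr (ih₁ U x y hU.1 H v w) (ih₂ U x y hU.2 H v w)
  | allO φ ih =>
    intro U x y hU H v w
    exact forall_congr' fun d => ih U x y hU H _ w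
  | allA φ ih =>
    intro U x y hU H v w
    exact forall_congr' fun d => ih U x y hU H v _
  | allS φ ih => intro U x y hU; exact hU.elim

theorem STerm.replace_lift (S' S : STerm L 0 0 0) {o a s : ℕ} :
    STerm.replace S' S (S.lift : STerm L o a s) = S'.lift := by
  cases S with
  | var i => exact i.elim0
  | s0 => simp [STerm.replace, STerm.lift, STerm.subst]
  | doFn b t => simp [STerm.replace, STerm.lift, STerm.subst]

theorem GroundAction.replace_s0 (α : GroundAction L) {o a s : ℕ} :
    STerm.replace .s0 α.sit (.s0 : STerm L o a s) = .s0 := by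
  simp [STerm.replace, STerm.lift, STerm.subst, GroundAction.sit]

theorem GroundAction.replace_eq_s0 (α : GroundAction L) {o a s : ℕ} {t : STerm L o a s}
    (ht : t = STerm.s0.lift ∨ t = α.sit.lift) : STerm.replace .s0 α.sit t = .s0 := by
  obtain rfl | rfl := ht
  · exact α.replace_s0
  · exact STerm.replace_lift _ _

/-! ### Uniformity under weakening and replacement -/

theorem Fm.Uniform.mono {o a s : ℕ} {φ : Fm L o a s} :
    ∀ {U U' : ∀ o a : ℕ, STerm L o a s → Prop}, φ.Uniform U → (∀ o a t, U o a t → U' o a t) →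
      φ.Uniform U' := by
  induction φ with
  | falsum => exact fun _ _ => trivial
  | eqO t u => exact fun _ _ => trivial
  | eqA t u => exact fun _ _ => trivial
  | eqS t u => exact fun h _ => h
  | pred P ts => exact fun _ _ => trivial
  | flu F ts t => exact fun h H => H _ _ t h
  | poss b t => exact fun h _ => h
  | prec t u => exact fun h _ => h
  | imp φ ψ ih₁ ih₂ => exact fun h H => ⟨ih₁ h.1 H, ih₂ h.2 H⟩
  | allO φ ih => exact fun h H => ih h H
  | allA φ ih => exact fun h H => ih h H
  | allS φ ih => exact fun h _ => h

theorem Fm.Uniform.replace {S' S : STerm L 0 0 0} {o a s : ℕ} {φ : Fm L o a s} :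
    ∀ {U U' : ∀ o a : ℕ, STerm L o a s → Prop}, φ.Uniform U →
      (∀ o a t, U o a t → U' o a (STerm.replace S' S t)) → (φ.replace S' S).Uniform U' := by
  induction φ with
  | falsum => exact fun _ _ => trivial
  | eqO t u => exact fun _ _ => trivial
  | eqA t u => exact fun _ _ => trivial
  | eqS t u => exact fun h _ => h.elim
  | pred P ts => exact fun _ _ => trivial
  | flu F ts t => exact fun h H => H _ _ t h
  | poss b t => exact fun h _ => h.elim
  | prec t u => exact fun h _ => h.elim
  | imp φ ψ ih₁ ih₂ => exact fun h H => ⟨ih₁ h.1 H, ih₂ h.2 H⟩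
  | allO φ ih => exact fun h H => ih h H
  | allA φ ih => exact fun h H => ih h H
  | allS φ ih => exact fun h _ => h.elim

/-- Replacing a situation term and then replacing it back. -/
theorem Fm.replace_replace {S' S : STerm L 0 0 0} {o a s : ℕ} {φ : Fm L o a s} :
    φ.Uniform (fun _ _ t => t = S.lift) → Fm.replace S S' (Fm.replace S' S φ) = φ := by
  induction φ with
  | falsum => exact fun _ => rfl
  | eqO t u => exact fun _ => rfl
  | eqA t u => exact fun _ => rfl
  | eqS t u => exact fun h => h.elim
  | pred P ts => exact fun _ => rfl
  | flu F ts t =>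
    rintro rfl
    simp only [Fm.replace, STerm.replace_lift]
  | poss b t => exact fun h => h.elim
  | prec t u => exact fun h => h.elim
  | imp φ ψ ih₁ ih₂ => exact fun h => congrArg₂ Fm.imp (ih₁ h.1) (ih₂ h.2)
  | allO φ ih => exact fun h => congrArg Fm.allO (ih h)
  | allA φ ih => exact fun h => congrArg Fm.allA (ih h)
  | allS φ ih => exact fun h => h.elim

theorem Theory.UniformIn.models_congr {T : Theory L} {S : STerm L 0 0 0} (hT : T.UniformIn S)
    {M : SCStr L Ob Ac Si} {N : SCStr L Ob Ac Si'} (h : M.SameStatic N)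
    (hflu : ∀ F v, M.flu F v (M.sit S) ↔ N.flu F v (N.sit S)) : M.Models T ↔ N.Models T := by
  refine forall₂_congr fun φ hφ => φ.realize_congr_of_uniform h _ _ _ (hT φ hφ) ?_ _ _
  rintro o a t rfl F v w u
  simpa only [STerm.eval_lift] using hflu F u

theorem Fm.UniformInVar.realize_congr {o : ℕ} {φ : Fm L o 0 1} (hφ : φ.UniformInVar)
    {M : SCStr L Ob Ac Si} {N : SCStr L Ob Ac Si'} (h : M.SameStatic N) {s : Si} {s' : Si'}
    (hflu : ∀ F v, M.flu F v s ↔ N.flu F v s') (v : Fin o → Ob) :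
    φ.Realize M v Fin.elim0 (fun _ => s) ↔ φ.Realize N v Fin.elim0 (fun _ => s') := by
  refine φ.realize_congr_of_uniform h _ _ _ hφ ?_ _ _
  rintro o a t rfl F v w u
  exact hflu F u

theorem SCStr.models_replace_iff {M : SCStr L Ob Ac Si} {T : Theory L} {S' S : STerm L 0 0 0} :
    M.Models (T.replace S' S) ↔
      ∀ φ ∈ T, (φ.replace S' S).Realize M Fin.elim0 Fin.elim0 Fin.elim0 := by
  simp [SCStr.Models, Theory.replace]

theorem SCStr.models_union {M : SCStr L Ob Ac Si} {T T' : Theory L} :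
    M.Models (T ∪ T') ↔ M.Models T ∧ M.Models T' := by
  simp [SCStr.Models, or_imp, forall_and]

theorem SCStr.models_iUnion {J : Type*} {M : SCStr L Ob Ac Si} {T : J → Theory L} :
    M.Models (⋃ j, T j) ↔ ∀ j, M.Models (T j) := by
  simp only [SCStr.Models, Set.mem_iUnion]
  exact ⟨fun h j φ hφ => h φ ⟨j, hφ⟩, fun h φ ⟨j, hφ⟩ => h j φ hφ⟩

/-! ## Semantics of successor state axioms -/

/-- The disjunct `e` holds at `v`, `a`, `s`. -/
def Effect.Holds {n : ℕ} (M : SCStr L Ob Ac Si) (v : Fin n → Ob) (a : Ac) (s : Si)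
    (e : Effect L n) : Prop :=
  ∃ u : Fin (n + e.bnd) → Ob, (∀ p : Fin n, u (p.addNat e.bnd) = v p) ∧
    a = M.act e.act (fun q => (e.arg q).eval M u) ∧ e.ctx.Realize M u Fin.elim0 (fun _ => s)

/-- The disjunct `e`, instantiated by `α` and rewritten, holds at `v`, `s`. -/
def Effect.InstHolds {n : ℕ} (α : GroundAction L) (M : SCStr L Ob Ac Si) (v : Fin n → Ob) (s : Si)
    (e : Effect L n) : Prop :=
  ∃ h : α.act = e.act, ∃ u : Fin (n + e.bnd) → Ob, (∀ p : Fin n, u (p.addNat e.bnd) = v p) ∧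
    (∀ q, M.con (α.argOf h q) = (e.arg q).eval M u) ∧ e.ctx.Realize M u Fin.elim0 (fun _ => s)

/-- The truth value `γ⁺ ∨ F ∧ ¬ γ⁻`, given those of `F` and of the disjuncts. -/
def SSA.Next {n : ℕ} (r : SSA L n) (E : Effect L n → Prop) (p : Prop) : Prop :=
  (∃ e ∈ r.pos, E e) ∨ (p ∧ ¬ ∃ e ∈ r.neg, E e)

theorem SSA.next_congr {n : ℕ} (r : SSA L n) {E E' : Effect L n → Prop} {p p' : Prop}
    (hE : ∀ e ∈ r.pos ++ r.neg, E e ↔ E' e) (hp : p ↔ p') : r.Next E p ↔ r.Next E' p' := by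
  refine or_congr (exists_congr fun e => and_congr_right fun he => hE e ?_)
    (and_congr hp (not_congr (exists_congr fun e => and_congr_right fun he => hE e ?_)))
  · exact List.mem_append_left _ he
  · exact List.mem_append_right _ he

theorem Effect.holds_congr {n : ℕ} (e : Effect L n) {M : SCStr L Ob Ac Si} {N : SCStr L Ob Ac Si'}
    (h : M.SameStatic N) {s : Si} {s' : Si'} (hflu : ∀ F v, M.flu F v s ↔ N.flu F v s')
    (v : Fin n → Ob) (a : Ac) : e.Holds M v a s ↔ e.Holds N v a s' := by
  simp only [Effect.Holds, h.act, OTerm.eval_congr h, e.ctx_uniform.realize_congr h hflu]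

theorem Effect.instHolds_congr {n : ℕ} (e : Effect L n) (α : GroundAction L)
    {M : SCStr L Ob Ac Si} {N : SCStr L Ob Ac Si'} (h : M.SameStatic N) {s : Si} {s' : Si'}
    (hflu : ∀ F v, M.flu F v s ↔ N.flu F v s') (v : Fin n → Ob) :
    e.InstHolds α M v s ↔ e.InstHolds α N v s' := by
  simp only [Effect.InstHolds, h.con, OTerm.eval_congr h, e.ctx_uniform.realize_congr h hflu]

theorem Effect.realize_toFm {n : ℕ} (e : Effect L n) (M : SCStr L Ob Ac Si) (v : Fin n → Ob)
    (w : Fin 1 → Ac) (x : Fin 1 → Si) : e.toFm.Realize M v w x ↔ e.Holds M v (w 0) (x 0) := by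
  rw [Effect.toFm, Fm.realize_exOs]
  refine exists_congr fun u => and_congr_right fun _ => ?_
  rw [Fm.realize_and, Fm.realize_subst M e.ctx _ u w x u Fin.elim0 (fun _ => x 0)
    (fun _ => rfl) (fun i => i.elim0) (fun i => by rw [Subsingleton.elim i 0]; rfl)]
  rfl

theorem Effect.realize_inst {n : ℕ} (e : Effect L n) (α : GroundAction L) (M : SCStr L Ob Ac Si)
    (v : Fin n → Ob) (s : Si) :
    (e.inst α).Realize M v Fin.elim0 (fun _ => s) ↔ e.InstHolds α M v s := by
  rw [Effect.inst, Effect.InstHolds]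
  split_ifs with h
  · rw [Fm.realize_exOs, exists_prop_of_true h]
    refine exists_congr fun u => and_congr_right fun _ => ?_
    rw [Fm.realize_and, Fm.realize_conj, List.forall_mem_ofFn_iff]
    rfl
  · exact ⟨False.elim, fun ⟨h', _⟩ => h h'⟩

theorem BAT.realize_ssaSentence (D : BAT L) (M : SCStr L Ob Ac Si) (F : L.Flu) :
    (D.ssaSentence F).Realize M Fin.elim0 Fin.elim0 Fin.elim0 ↔ ∀ s a v,
      M.flu F v (M.doFn a s) ↔ (D.ssa F).Next (Effect.Holds M v a s) (M.flu F v s) := by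
  refine forall_congr' fun s => forall_congr' fun a => ?_
  rw [Fm.realize_allOs]
  refine forall_congr' fun v => ?_
  simp only [Fm.realize_iff, Fm.realize_or, Fm.realize_and, Fm.realize_neg, Fm.realize_disj,
    List.mem_map, exists_exists_and_eq_and, Effect.realize_toFm]
  rfl

theorem BAT.models_ssaTheory (D : BAT L) (M : SCStr L Ob Ac Si) :
    M.Models D.ssaTheory ↔ ∀ F s a v,
      M.flu F v (M.doFn a s) ↔ (D.ssa F).Next (Effect.Holds M v a s) (M.flu F v s) := by
  simp only [SCStr.Models, BAT.ssaTheory, Set.forall_mem_range, BAT.realize_ssaSentence]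

theorem BAT.realize_instSentence (D : BAT L) (α : GroundAction L) (M : SCStr L Ob Ac Si)
    (g : GAtom L) : (D.instSentence α g).Realize M Fin.elim0 Fin.elim0 Fin.elim0 ↔
      (M.flu g.flu (fun p => M.con (g.arg p)) (M.sit α.sit) ↔
        (D.ssa g.flu).Next (Effect.InstHolds α M (fun p => M.con (g.arg p)) M.s0)
          (M.flu g.flu (fun p => M.con (g.arg p)) M.s0)) := by
  have key : ∀ φ : Fm L (L.fluArity g.flu) 0 1,
      (φ.subst (⟨fun p => .con (g.arg p), Fin.elim0, fun _ => .s0⟩ : TSub L _ 0 1 0 0 0)).Realize M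
        Fin.elim0 Fin.elim0 Fin.elim0 ↔
      φ.Realize M (fun p => M.con (g.arg p)) Fin.elim0 (fun _ => M.s0) := fun φ =>
    Fm.realize_subst M φ _ _ _ _ _ _ _ (fun _ => rfl) (fun i => i.elim0) (fun _ => rfl)
  simp only [BAT.instSentence, Fm.realize_iff, Fm.realize_or, Fm.realize_and, Fm.realize_neg, key,
    Fm.realize_disj, List.mem_map, exists_exists_and_eq_and, Effect.realize_inst]
  rfl

theorem BAT.models_inst (D : BAT L) (α : GroundAction L) (M : SCStr L Ob Ac Si)
    (Ω : Set (GAtom L)) : M.Models (D.inst α Ω) ↔ ∀ g ∈ Ω,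
      (M.flu g.flu (fun p => M.con (g.arg p)) (M.sit α.sit) ↔
        (D.ssa g.flu).Next (Effect.InstHolds α M (fun p => M.con (g.arg p)) M.s0)
          (M.flu g.flu (fun p => M.con (g.arg p)) M.s0)) := by
  simp only [SCStr.Models, BAT.inst, Set.forall_mem_image, BAT.realize_instSentence]

/-! ## Structures with changed fluents -/

/-- The structure `M` with other fluents. -/
def SCStr.setFlu (M : SCStr L Ob Ac Si)
    (k : (F : L.Flu) → (Fin (L.fluArity F) → Ob) → Si → Prop) : SCStr L Ob Ac Si :=
  { M with flu := k }

/-- The structure `M` with the fluents given by `f` in all situations. -/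
def SCStr.withFlu (M : SCStr L Ob Ac Si) (f : (F : L.Flu) → (Fin (L.fluArity F) → Ob) → Prop) :
    SCStr L Ob Ac Si := M.setFlu fun F v _ => f F v

/-- Two situations, `S₀` with the fluents `f` and `do(a, s)` with the fluents `g`. -/
def SCStr.twoStage (M : SCStr L Ob Ac Si)
    (f g : (F : L.Flu) → (Fin (L.fluArity F) → Ob) → Prop) : SCStr L Ob Ac Bool where
  act := M.act
  con := M.con
  fn := M.fn
  pred := M.pred
  flu := fun F v b => cond b (g F v) (f F v)
  s0 := false
  doFn := fun _ _ => true
  poss := fun _ _ => False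
  prec := fun _ _ => False

/-- Some atom from `Ω` denotes the value of the fluent `F` at `v`. -/
def SCStr.Hit (M : SCStr L Ob Ac Si) (Ω : Set (GAtom L)) (F : L.Flu)
    (v : Fin (L.fluArity F) → Ob) : Prop :=
  ∃ t, (⟨F, t⟩ : GAtom L) ∈ Ω ∧ v = fun p => M.con (t p)

/-- Everything except the fluents is shared with `M`, so quantifying over structures amounts to
quantifying over interpretations `k` of the fluents. -/
theorem SCStr.exists_simOff_iff {M : SCStr L Ob Ac Si} {T : Theory L} {Ω : Set (GAtom L)} :
    (∃ K : SCStr L Ob Ac Si, K.Models T ∧ K.SimOff Ω M) ↔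
      ∃ k, (M.setFlu k).Models T ∧
        ∀ F v s, ¬ (M.Hit Ω F v ∧ s = M.s0) → (k F v s ↔ M.flu F v s) := by
  constructor
  · rintro ⟨K, hK, h⟩
    have hKM : K = M.setFlu K.flu := by
      obtain ⟨h₁, h₂, h₃, h₄, h₅, h₆, h₇, h₈, -⟩ := h
      cases K
      simp only at h₁ h₂ h₃ h₄ h₅ h₆ h₇ h₈
      simp only [SCStr.setFlu, h₁, h₂, h₃, h₄, h₅, h₆, h₇, h₈]
    refine ⟨K.flu, hKM ▸ hK, fun F v s hs => h.flu F v s ?_⟩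
    rintro ⟨t, ht, rfl, rfl⟩
    exact hs ⟨⟨t, ht, by rw [h.con]⟩, h.s0⟩
  · rintro ⟨k, hk, h⟩
    refine ⟨_, hk, rfl, rfl, rfl, rfl, rfl, rfl, rfl, rfl, fun F v s hs => h F v s ?_⟩
    rintro ⟨⟨t, ht, rfl⟩, rfl⟩
    exact hs ⟨t, ht, rfl, rfl⟩

/-! ## Semantic characterization of updates -/

namespace BAT

/-- The fluents after the action `α` in a state with the fluents `f`, when only the atoms from `Ω`
are affected. -/
def Updated (D : BAT L) (α : GroundAction L) (Ω : Set (GAtom L)) (M : SCStr L Ob Ac Si)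
    (f : (F : L.Flu) → (Fin (L.fluArity F) → Ob) → Prop) (F : L.Flu)
    (v : Fin (L.fluArity F) → Ob) : Prop :=
  (M.Hit Ω F v ∧ (D.ssa F).Next (Effect.InstHolds α (M.withFlu f) v M.s0) (f F v)) ∨
    (¬ M.Hit Ω F v ∧ f F v)

/-- After the replacement of S_α by S₀, both situations of `G` are read at the single state `st` of
`M`. Forgetting then exposes an earlier state f at S₀: it agrees with `st` off Ω, and D_ss[Ω]
computes `st` from it on Ω. -/
theorem IsUpdate.models_iff {D : BAT L} {α : GroundAction L} {T Q : Theory L}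
    {Ω : Set (GAtom L)} (hT : T.UniformIn .s0) (hQ : D.IsUpdate α T Ω Q) [Nonempty Ob]
    [Nonempty Ac] [Nonempty Si] (M : SCStr L Ob Ac Si) :
    M.Models Q ↔ ∃ f, (M.withFlu f).Models T ∧
      ∀ F v, M.flu F v M.s0 ↔ D.Updated α Ω M f F v := by
  obtain ⟨G, hG, hforget, hQ⟩ := hQ
  set st : (F : L.Flu) → (Fin (L.fluArity F) → Ob) → Prop := fun F v => M.flu F v M.s0 with hst
  -- The two situations are separated again, with the same state in both, since forgetting is
  -- specified only for structures in which S₀ ≠ S_α.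
  have h₁ : M.Models (G.replace .s0 α.sit) ↔ (M.twoStage st st).Models G := by
    rw [SCStr.models_replace_iff]
    refine forall₂_congr fun φ hφ => φ.realize_replace (M := M) (N := M.twoStage st st)
      ⟨rfl, rfl, rfl, rfl⟩ _ _ _ _ _ (hG φ hφ) ?_ _ _
    rintro o a t ht F v w u
    rw [α.replace_eq_s0 ht]
    simp [SCStr.twoStage, STerm.eval, hst]
  rw [hQ Ob Ac Si M, h₁, hforget Ob Ac Bool (M.twoStage st st) Bool.false_ne_true,
    SCStr.exists_simOff_iff]
  have h₂ : ∀ k, (M.twoStage st st |>.setFlu k).Models T ↔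
      (M.withFlu fun F v => k F v false).Models T := fun k =>
    hT.models_congr ⟨rfl, rfl, rfl, rfl⟩ fun F v => Iff.rfl
  have h₃ : ∀ k, (M.twoStage st st |>.setFlu k).Models (D.inst α Ω) ↔ ∀ g ∈ Ω,
      (k g.flu (fun p => M.con (g.arg p)) true ↔ (D.ssa g.flu).Next (Effect.InstHolds α
        (M.withFlu fun F v => k F v false) (fun p => M.con (g.arg p)) M.s0)
          (k g.flu (fun p => M.con (g.arg p)) false)) := fun k => by
    rw [D.models_inst]
    refine forall₂_congr fun g _ => iff_congr Iff.rfl (SSA.next_congr _ (fun e _ => ?_) Iff.rfl)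
    exact e.instHolds_congr α (M := (M.twoStage st st).setFlu k)
      (N := M.withFlu fun F v => k F v false) ⟨rfl, rfl, rfl, rfl⟩ (fun F v => Iff.rfl) _
  simp only [SCStr.models_union, h₂, h₃]
  constructor
  · rintro ⟨k, ⟨hk, hkT⟩, hoff⟩
    refine ⟨fun F v => k F v false, hkT, fun F v => ?_⟩
    -- Only atoms at S₀ (`false`) are forgotten, so the state at S_α (`true`) is still that of `M`.
    have htrue : k F v true ↔ M.flu F v M.s0 := hoff F v true fun h => Bool.false_ne_true h.2.symm
    by_cases hv : M.Hit Ω F v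
    · obtain ⟨t, ht, rfl⟩ := id hv
      rw [← htrue, hk _ ht]
      simp only [Updated, hv, true_and, not_true, false_and, or_false]
    · simp only [Updated, hv, false_and, not_false_iff, true_and, false_or]
      exact (hoff F v false fun h => hv h.1).symm
  · rintro ⟨f, hf, hM⟩
    -- The earlier state f is put at S₀, and the state of `M` is kept at S_α.
    refine ⟨fun F v b => cond b (st F v) (f F v), ⟨fun g hg => ?_, hf⟩, fun F v b hb => ?_⟩
    · have hv : M.Hit Ω g.flu fun p => M.con (g.arg p) := ⟨g.arg, hg, rfl⟩
      have := hM g.flu fun p => M.con (g.arg p)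
      simp only [Updated, hv, true_and, not_true, false_and, or_false] at this
      exact this
    · cases b with
      | true => exact Iff.rfl
      | false =>
        have hv : ¬ M.Hit Ω F v := fun h => hb ⟨h, rfl⟩
        have := hM F v
        simp only [Updated, hv, false_and, not_false_iff, true_and, false_or] at this
        exact this.symm

/-! ## Local-effect progressions are progressions -/

/-- Disjointness of the ranges of action functions justifies the rewriting to false, and injectivity
the rewriting of a = B(t̄) to c̄ = t̄. -/
theorem instHolds_iff_holds {n : ℕ} (α : GroundAction L) {M : SCStr L Ob Ac Si}
    (hM : M.UniqueNames) (v : Fin n → Ob) (s : Si) (e : Effect L n) :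
    e.InstHolds α M v s ↔ e.Holds M v (M.act α.act fun q => M.con (α.arg q)) s := by
  obtain ⟨m, B, arg, ctx, hctx⟩ := e
  constructor
  · rintro ⟨h, u, hu, hq, hc⟩
    refine ⟨u, hu, ?_, hc⟩
    dsimp only at h
    subst h
    exact congrArg _ (funext hq)
  · rintro ⟨u, hu, ha, hc⟩
    have h : α.act = B := by
      by_contra hne
      exact hM.act_ne _ _ hne _ _ ha
    refine ⟨h, u, hu, ?_, hc⟩
    subst h
    exact congrFun (hM.act_inj _ _ _ ha)

/-- This is where local effect enters: each variable of the fluent is an argument of the action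
term, so a firing disjunct equates it with a constant of α. -/
theorem LocalEffect.hit_omega {D : BAT L} (hD : D.LocalEffect) {α : GroundAction L} {F : L.Flu}
    {e : Effect L (L.fluArity F)} (he : e ∈ (D.ssa F).pos ++ (D.ssa F).neg)
    {M : SCStr L Ob Ac Si} {v : Fin (L.fluArity F) → Ob} {s : Si} (h : e.InstHolds α M v s) :
    M.Hit (D.omega α) F v := by
  obtain ⟨hact, u, hu, hq, -⟩ := h
  choose q hq' using hD F e he
  refine ⟨fun p => α.argOf hact (q p), ⟨e, he, hact, fun p => ⟨q p, hq' p, rfl⟩⟩, ?_⟩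
  funext p
  rw [hq, hq', OTerm.eval, hu]

theorem _root_.SCStr.UniqueNames.of_sameStatic {M : SCStr L Ob Ac Si} (hM : M.UniqueNames)
    {N : SCStr L Ob Ac Si'} (h : M.SameStatic N) : N.UniqueNames :=
  ⟨h.con ▸ hM.con_inj, h.act ▸ hM.act_ne, h.act ▸ hM.act_inj⟩

/-- Under unique names, the update along `Ω(S₀)` is the successor state. -/
theorem LocalEffect.updated_iff {D : BAT L} (hD : D.LocalEffect) (α : GroundAction L)
    {M : SCStr L Ob Ac Si} (hM : M.UniqueNames) {N : SCStr L Ob Ac Si'} (h : M.SameStatic N)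
    {f : (F : L.Flu) → (Fin (L.fluArity F) → Ob) → Prop} {s : Si'}
    (hf : ∀ F v, f F v ↔ N.flu F v s) (F : L.Flu) (v : Fin (L.fluArity F) → Ob) :
    D.Updated α (D.omega α) M f F v ↔ (D.ssa F).Next
      (Effect.Holds N v (N.act α.act fun q => N.con (α.arg q)) s) (N.flu F v s) := by
  have hN : N.UniqueNames := hM.of_sameStatic h
  have key : (D.ssa F).Next (Effect.InstHolds α (M.withFlu f) v M.s0) (f F v) ↔ (D.ssa F).Next
      (Effect.Holds N v (N.act α.act fun q => N.con (α.arg q)) s) (N.flu F v s) := by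
    refine SSA.next_congr _ (fun e _ => ?_) (hf F v)
    rw [← instHolds_iff_holds α hN]
    exact e.instHolds_congr α (M := M.withFlu f) ⟨h.act, h.con, h.fn, h.pred⟩
      (fun F v => hf F v) v
  rw [← key, Updated]
  by_cases hv : M.Hit (D.omega α) F v
  · simp only [hv, true_and, not_true, false_and, or_false]
  -- Off Ω no disjunct fires, so γ⁺ and γ⁻ are false and the successor state axiom reduces to
  -- inertia.
  · have hno : ∀ e ∈ (D.ssa F).pos ++ (D.ssa F).neg,
        ¬ e.InstHolds α (M.withFlu f) v M.s0 := fun e he h =>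
          hv (hD.hit_omega (M := M.withFlu f) he h)
    have hpos : ¬ ∃ e ∈ (D.ssa F).pos, e.InstHolds α (M.withFlu f) v M.s0 :=
      fun ⟨e, he, h⟩ => hno e (List.mem_append_left _ he) h
    have hneg : ¬ ∃ e ∈ (D.ssa F).neg, e.InstHolds α (M.withFlu f) v M.s0 :=
      fun ⟨e, he, h⟩ => hno e (List.mem_append_right _ he) h
    simp only [hv, false_and, not_false_iff, true_and, false_or, SSA.Next, hpos, hneg, and_true]

/-- The fluents after a sequence of actions (the last one first) from the state `f`. -/
def stateAfter (D : BAT L) (M : SCStr L Ob Ac Si)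
    (f : (F : L.Flu) → (Fin (L.fluArity F) → Ob) → Prop) :
    List Ac → (F : L.Flu) → (Fin (L.fluArity F) → Ob) → Prop
  | [] => f
  | a :: l => fun F v => (D.ssa F).Next
      (Effect.Holds (M.withFlu (stateAfter D M f l)) v a M.s0) (stateAfter D M f l F v)

/-- The tree of situations over the objects and actions of `M`, from the initial state `f`. -/
def treeModel (D : BAT L) (M : SCStr L Ob Ac Si)
    (f : (F : L.Flu) → (Fin (L.fluArity F) → Ob) → Prop) : SCStr L Ob Ac (List Ac) where
  act := M.act
  con := M.con
  fn := M.fn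
  pred := M.pred
  flu := fun F v l => D.stateAfter M f l F v
  s0 := []
  doFn := fun a l => a :: l
  poss := fun a l => ∃ A x, a = M.act A x ∧
    (D.pre A).Realize (M.withFlu (D.stateAfter M f l)) x Fin.elim0 (fun _ => M.s0)
  prec := fun l l' => l <:+ l'

/-- Situations are action sequences with the newest action first, so `do` is cons, ≼ is the suffix
order and induction over situations is list induction. The successor state axioms hold by the
recursion defining the states. `Poss` is read off from the form A(x̄) of an action, unambiguously by
unique names. -/
theorem treeModel_modelsDynamics (D : BAT L) {M : SCStr L Ob Ac Si} (hM : M.UniqueNames)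
    (f : (F : L.Flu) → (Fin (L.fluArity F) → Ob) → Prop) :
    (D.treeModel M f).ModelsDynamics D where
  foundational :=
    { do_inj := fun a₁ a₂ s₁ s₂ h => List.cons.inj h
      initial := fun s h => h.2 (List.suffix_nil.1 h.1)
      prec_iff := fun s₁ s₂ => by
        constructor
        · rintro ⟨l, rfl⟩
          -- The action performed right after `s₁` is the last entry of the part preceding the
          -- suffix `s₁`.
          rcases l.eq_nil_or_concat with rfl | ⟨l, a, rfl⟩
          · exact Or.inr rfl
          · exact Or.inl ⟨a, l, by simp [treeModel]⟩
        · rintro (⟨a, l, h⟩ | rfl)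
          · exact ⟨l ++ [a], by rw [← h]; simp [treeModel]⟩
          · exact List.suffix_rfl
      induction := fun P h₀ h s => by
        induction s with
        | nil => exact h₀
        | cons a s ih => exact h a s ih }
  uniqueNames := hM.of_sameStatic ⟨rfl, rfl, rfl, rfl⟩
  preconditions := fun A x s => by
    have key : ∀ A x, (D.pre A).Realize (M.withFlu (D.stateAfter M f s)) x Fin.elim0
        (fun _ => M.s0) ↔ (D.pre A).Realize (D.treeModel M f) x Fin.elim0 (fun _ => s) :=
      fun A x => (D.pre_uniform A).realize_congr (M := M.withFlu (D.stateAfter M f s))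
        (N := D.treeModel M f) ⟨rfl, rfl, rfl, rfl⟩ (fun F v => Iff.rfl) x
    rw [← key]
    constructor
    · rintro ⟨B, y, h, hB⟩
      have hAB : A = B := by
        by_contra hne
        exact hM.act_ne _ _ hne _ _ h
      subst hAB
      obtain rfl := hM.act_inj _ _ _ h
      exact hB
    · exact fun h => ⟨A, x, rfl, h⟩
  ssa := by
    rw [models_ssaTheory]
    refine fun F s a v => SSA.next_congr _ (fun e _ => ?_) Iff.rfl
    exact e.holds_congr (N := D.treeModel M f) (M := M.withFlu (D.stateAfter M f s))
      ⟨rfl, rfl, rfl, rfl⟩ (fun F v => Iff.rfl) v a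

theorem IsLocalEffectProgression.isProgression {D : BAT L} (hD : D.LocalEffect)
    {α : GroundAction L} {P : Theory L} (hP : D.IsLocalEffectProgression α P) :
    D.IsProgression α P := by
  refine ⟨hP.uniform, fun Ob Ac Si _ _ _ M hM => ?_⟩
  -- Copying the state at S_α to all situations turns `P` in `M` into P(S₀/S_α) in `M₀`, where the
  -- description of updates applies.
  set M₀ := M.withFlu fun F v => M.flu F v (M.sit α.sit) with hM₀
  have h₁ : M.Models P ↔ M₀.Models (P.replace .s0 α.sit) := by
    rw [SCStr.models_replace_iff]
    refine forall₂_congr fun φ hφ => (φ.realize_replace (M := M₀) (N := M)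
      ⟨rfl, rfl, rfl, rfl⟩ _ _ _ _ _ (hP.uniform φ hφ) ?_ _ _).symm
    rintro o a t rfl F v w u
    rw [STerm.eval_lift]
    rfl
  rw [h₁, hP.update.models_iff D.init_uniform]
  have hU : M₀.UniqueNames := hM.uniqueNames.of_sameStatic ⟨rfl, rfl, rfl, rfl⟩
  constructor
  · rintro ⟨f, hf, hM'⟩
    -- The tree grown from f is the required model: its state at S_α is the successor of f, which is
    -- the state of `M` at S_α.
    refine ⟨List Ac, D.treeModel M f, ⟨D.treeModel_modelsDynamics hM.uniqueNames f, ?_⟩,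
      rfl, rfl, rfl, rfl, fun F v => (hM' F v).trans ?_⟩
    · exact (D.init_uniform.models_congr (M := M₀.withFlu f) (N := D.treeModel M f)
        ⟨rfl, rfl, rfl, rfl⟩ fun F v => Iff.rfl).1 hf
    · rw [hD.updated_iff α hU (N := D.treeModel M f) ⟨rfl, rfl, rfl, rfl⟩
        (s := []) (f := f) (fun F v => Iff.rfl)]
      exact ((D.models_ssaTheory _).1 (D.treeModel_modelsDynamics hM.uniqueNames f).ssa
        F [] _ v).symm
  · rintro ⟨Si', M', ⟨hdyn, hinit⟩, hsim⟩
    have hstat : M₀.SameStatic M' := ⟨hsim.act, hsim.con, hsim.fn, hsim.pred⟩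
    refine ⟨fun F v => M'.flu F v M'.s0, ?_, fun F v => (hsim.flu F v).trans ?_⟩
    · exact (D.init_uniform.models_congr (M := M₀.withFlu _) (N := M') ⟨hsim.act, hsim.con, hsim.fn, hsim.pred⟩
        fun F v => Iff.rfl).2 hinit
    · rw [hD.updated_iff α hU hstat (s := M'.s0) (fun F v => Iff.rfl)]
      exact (D.models_ssaTheory _).1 hdyn.ssa F M'.s0 _ v

end BAT

/-! ## Signatures -/

/-- The symbols of a formula outside situation terms (for formulas without equalities between
situations, `Poss` and `≼`). -/
def Fm.nsig : {o a s : ℕ} → Fm L o a s → Set (Symb L)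
  | _, _, _, .falsum => ∅
  | _, _, _, .eqO t u => t.sig ∪ u.sig
  | _, _, _, .eqA t u => t.sig ∪ u.sig
  | _, _, _, .eqS _ _ => ∅
  | _, _, _, .pred P ts => {Symb.pred P} ∪ ⋃ i, (ts i).sig
  | _, _, _, .flu F ts _ => {Symb.flu F} ∪ ⋃ i, (ts i).sig
  | _, _, _, .poss _ _ => ∅
  | _, _, _, .prec _ _ => ∅
  | _, _, _, .imp φ ψ => φ.nsig ∪ ψ.nsig
  | _, _, _, .allO φ => φ.nsig
  | _, _, _, .allA φ => φ.nsig
  | _, _, _, .allS φ => φ.nsig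

theorem Fm.nsig_subset_sig {o a s : ℕ} (φ : Fm L o a s) : φ.nsig ⊆ φ.sig := by
  induction φ with
  | falsum => exact subset_rfl
  | eqO t u => exact subset_rfl
  | eqA t u => exact subset_rfl
  | eqS t u => exact Set.empty_subset _
  | pred P ts => exact subset_rfl
  | flu F ts t => exact Set.subset_union_left
  | poss b t => exact Set.empty_subset _
  | prec t u => exact Set.empty_subset _
  | imp φ ψ ih₁ ih₂ => exact Set.union_subset_union ih₁ ih₂
  | allO φ ih => exact ih
  | allA φ ih => exact ih
  | allS φ ih => exact ih

theorem OTerm.doFn_notMem_sig {o : ℕ} (t : OTerm L o) : Symb.doFn ∉ t.sig := by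
  induction t with
  | var i => simp [OTerm.sig]
  | con c => simp [OTerm.sig]
  | fn f ts ih => simpa [OTerm.sig] using ih

theorem ATerm.doFn_notMem_sig {o a : ℕ} (t : ATerm L o a) : Symb.doFn ∉ t.sig := by
  cases t with
  | var i => simp [ATerm.sig]
  | fn A ts => simp [ATerm.sig, OTerm.doFn_notMem_sig]

/-- `do` occurs only in situation terms. This removes the one symbol outside Δ₁ that groups of
successor state axioms may share. -/
theorem Fm.doFn_notMem_nsig {o a s : ℕ} (φ : Fm L o a s) : Symb.doFn ∉ φ.nsig := by
  induction φ with
  | falsum => simp [Fm.nsig]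
  | eqO t u => simp [Fm.nsig, OTerm.doFn_notMem_sig]
  | eqA t u => simp [Fm.nsig, ATerm.doFn_notMem_sig]
  | eqS t u => simp [Fm.nsig]
  | pred P ts => simp [Fm.nsig, OTerm.doFn_notMem_sig]
  | flu F ts t => simp [Fm.nsig, OTerm.doFn_notMem_sig]
  | poss b t => simp [Fm.nsig]
  | prec t u => simp [Fm.nsig]
  | imp φ ψ ih₁ ih₂ => simp [Fm.nsig, ih₁, ih₂]
  | allO φ ih => exact ih
  | allA φ ih => exact ih
  | allS φ ih => exact ih

theorem OTerm.sig_finite {o : ℕ} (t : OTerm L o) : t.sig.Finite := by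
  induction t with
  | var i => exact Set.finite_empty
  | con c => exact Set.finite_singleton _
  | fn f ts ih => exact (Set.finite_singleton _).union (Set.finite_iUnion ih)

theorem ATerm.sig_finite {o a : ℕ} (t : ATerm L o a) : t.sig.Finite := by
  cases t with
  | var i => exact Set.finite_empty
  | fn A ts => exact (Set.finite_singleton _).union (Set.finite_iUnion fun i => (ts i).sig_finite)

theorem STerm.sig_finite {o a s : ℕ} (t : STerm L o a s) : t.sig.Finite := by
  induction t with
  | var i => exact Set.finite_empty
  | s0 => exact Set.finite_singleton _
  | doFn b t ih => exact ((Set.finite_singleton _).union b.sig_finite).union ih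

theorem Fm.sig_finite {o a s : ℕ} (φ : Fm L o a s) : φ.sig.Finite := by
  induction φ with
  | falsum => exact Set.finite_empty
  | eqO t u => exact t.sig_finite.union u.sig_finite
  | eqA t u => exact t.sig_finite.union u.sig_finite
  | eqS t u => exact t.sig_finite.union u.sig_finite
  | pred P ts => exact (Set.finite_singleton _).union (Set.finite_iUnion fun i => (ts i).sig_finite)
  | flu F ts t =>
    exact ((Set.finite_singleton _).union (Set.finite_iUnion fun i => (ts i).sig_finite)).union
      t.sig_finite
  | poss b t => exact ((Set.finite_singleton _).union b.sig_finite).union t.sig_finite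
  | prec t u => exact ((Set.finite_singleton _).union t.sig_finite).union u.sig_finite
  | imp φ ψ ih₁ ih₂ => exact ih₁.union ih₂
  | allO φ ih => exact ih
  | allA φ ih => exact ih
  | allS φ ih => exact ih

theorem Theory.sig_finite {T : Theory L} (hT : T.Finite) : T.sig.Finite :=
  hT.biUnion fun φ _ => φ.sig_finite

theorem Theory.sig_subset_iff {T : Theory L} {X : Set (Symb L)} :
    T.sig ⊆ X ↔ ∀ φ ∈ T, Fm.sig φ ⊆ X := Set.iUnion₂_subset_iff

theorem Theory.sig_union (T T' : Theory L) :
    Theory.sig (T ∪ T' : Set (Sentence L)) = T.sig ∪ T'.sig := Set.biUnion_union _ _ _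

theorem Theory.subset_sig {T : Theory L} {φ : Sentence L} (h : φ ∈ T) : φ.sig ⊆ T.sig :=
  Set.subset_biUnion_of_mem (u := Fm.sig) h

/-! ### Symbols and uniformity of the derived connectives -/

section Connectives

variable {o a s : ℕ}

theorem Fm.nsig_neg (φ : Fm L o a s) : φ.neg.nsig = φ.nsig := Set.union_empty _

theorem Fm.nsig_and (φ ψ : Fm L o a s) : (φ.and ψ).nsig = φ.nsig ∪ ψ.nsig := by
  simp [Fm.and, Fm.nsig_neg, Fm.nsig]

theorem Fm.nsig_or (φ ψ : Fm L o a s) : (φ.or ψ).nsig = φ.nsig ∪ ψ.nsig := by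
  simp [Fm.or, Fm.nsig_neg, Fm.nsig]

theorem Fm.nsig_iff (φ ψ : Fm L o a s) : (φ.iff ψ).nsig = φ.nsig ∪ ψ.nsig := by
  simp only [Fm.iff, Fm.nsig_and, Fm.nsig]
  rw [Set.union_comm ψ.nsig, Set.union_self]

theorem Fm.nsig_conj (l : List (Fm L o a s)) : (Fm.conj l).nsig = ⋃ φ ∈ l, φ.nsig := by
  induction l with
  | nil => simp [Fm.conj, Fm.nsig]
  | cons φ l ih =>
    refine (Fm.nsig_and φ (Fm.conj l)).trans ?_
    ext x
    simp [ih]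

theorem Fm.nsig_disj (l : List (Fm L o a s)) : (Fm.disj l).nsig = ⋃ φ ∈ l, φ.nsig := by
  induction l with
  | nil => simp [Fm.disj, Fm.nsig]
  | cons φ l ih =>
    refine (Fm.nsig_or φ (Fm.disj l)).trans ?_
    ext x
    simp [ih]

theorem Fm.nsig_exOs (m : ℕ) (φ : Fm L (o + m) a s) : (Fm.exOs m φ).nsig = φ.nsig := by
  induction m with
  | zero => rfl
  | succ m ih =>
    rw [Fm.exOs, ih, Fm.exO, Fm.nsig_neg, Fm.nsig, Fm.nsig_neg]

theorem Fm.nsig_allOs {n : ℕ} (φ : Fm L n a s) : (Fm.allOs n φ).nsig = φ.nsig := by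
  induction n with
  | zero => rfl
  | succ n ih => rw [Fm.allOs, ih, Fm.nsig]

theorem Fm.sig_allOs {n : ℕ} (φ : Fm L n a s) : (Fm.allOs n φ).sig = φ.sig := by
  induction n with
  | zero => rfl
  | succ n ih => rw [Fm.allOs, ih, Fm.sig]

variable {U : ∀ o a : ℕ, STerm L o a s → Prop}

theorem Fm.Uniform.neg {φ : Fm L o a s} (h : φ.Uniform U) : φ.neg.Uniform U := ⟨h, trivial⟩

theorem Fm.Uniform.and {φ ψ : Fm L o a s} (h : φ.Uniform U) (h' : ψ.Uniform U) :
    (φ.and ψ).Uniform U := ⟨⟨h, h', trivial⟩, trivial⟩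

theorem Fm.Uniform.or {φ ψ : Fm L o a s} (h : φ.Uniform U) (h' : ψ.Uniform U) :
    (φ.or ψ).Uniform U := ⟨⟨h, trivial⟩, h'⟩

theorem Fm.Uniform.iff {φ ψ : Fm L o a s} (h : φ.Uniform U) (h' : ψ.Uniform U) :
    (φ.iff ψ).Uniform U := Fm.Uniform.and ⟨h, h'⟩ ⟨h', h⟩

theorem Fm.Uniform.conj {l : List (Fm L o a s)} (h : ∀ φ ∈ l, φ.Uniform U) :
    (Fm.conj l).Uniform U := by
  induction l with
  | nil => exact ⟨trivial, trivial⟩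
  | cons φ l ih =>
    rw [List.forall_mem_cons] at h
    exact Fm.Uniform.and h.1 (ih h.2)

theorem Fm.Uniform.disj {l : List (Fm L o a s)} (h : ∀ φ ∈ l, φ.Uniform U) :
    (Fm.disj l).Uniform U := by
  induction l with
  | nil => exact trivial
  | cons φ l ih =>
    rw [List.forall_mem_cons] at h
    exact Fm.Uniform.or h.1 (ih h.2)

theorem Fm.Uniform.exOs {m : ℕ} {φ : Fm L (o + m) a s} (h : φ.Uniform U) :
    (Fm.exOs m φ).Uniform U := by
  induction m with
  | zero => exact h
  | succ m ih => exact ih ⟨⟨h, trivial⟩, trivial⟩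

end Connectives

/-! ### Symbols under substitution and replacement -/

theorem OTerm.sig_subset_sig_subst {o o' : ℕ} (σ : Fin o → OTerm L o') (t : OTerm L o) :
    t.sig ⊆ (t.subst σ).sig := by
  induction t with
  | var i => exact Set.empty_subset _
  | con c => exact subset_rfl
  | fn f ts ih => exact Set.union_subset_union_right _ (Set.iUnion_mono ih)

theorem ATerm.sig_subset_sig_subst {o a o' a' : ℕ} (σ : Fin o → OTerm L o')
    (τ : Fin a → ATerm L o' a') (t : ATerm L o a) : t.sig ⊆ (t.subst σ τ).sig := by
  cases t with
  | var i => exact Set.empty_subset _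
  | fn A ts =>
    exact Set.union_subset_union_right _ (Set.iUnion_mono fun i => (ts i).sig_subset_sig_subst σ)

theorem Fm.nsig_subset_nsig_subst {o a s : ℕ} (φ : Fm L o a s) :
    ∀ {o' a' s' : ℕ} (ρ : TSub L o a s o' a' s'), φ.nsig ⊆ (φ.subst ρ).nsig := by
  induction φ with
  | falsum => exact fun _ => subset_rfl
  | eqO t u =>
    exact fun ρ => Set.union_subset_union (t.sig_subset_sig_subst _) (u.sig_subset_sig_subst _)
  | eqA t u =>
    exact fun ρ => Set.union_subset_union (t.sig_subset_sig_subst _ _) (u.sig_subset_sig_subst _ _)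
  | eqS t u => exact fun _ => subset_rfl
  | pred P ts =>
    exact fun ρ =>
      Set.union_subset_union_right _ (Set.iUnion_mono fun i => (ts i).sig_subset_sig_subst _)
  | flu F ts t =>
    exact fun ρ =>
      Set.union_subset_union_right _ (Set.iUnion_mono fun i => (ts i).sig_subset_sig_subst _)
  | poss b t => exact fun _ => subset_rfl
  | prec t u => exact fun _ => subset_rfl
  | imp φ ψ ih₁ ih₂ => exact fun ρ => Set.union_subset_union (ih₁ ρ) (ih₂ ρ)
  | allO φ ih => exact fun ρ => ih ρ.underO
  | allA φ ih => exact fun ρ => ih ρ.underA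
  | allS φ ih => exact fun ρ => ih ρ.underS

theorem OTerm.sig_subst_subset {X : Set (Symb L)} {o o' : ℕ} {σ : Fin o → OTerm L o'}
    (hσ : ∀ i, (σ i).sig ⊆ X) {t : OTerm L o} (ht : t.sig ⊆ X) : (t.subst σ).sig ⊆ X := by
  induction t with
  | var i => exact hσ i
  | con c => exact ht
  | fn f ts ih =>
    simp only [OTerm.sig, OTerm.subst, Set.union_subset_iff, Set.iUnion_subset_iff] at ht ⊢
    exact ⟨ht.1, fun i => ih i (ht.2 i)⟩

theorem ATerm.sig_subst_subset {X : Set (Symb L)} {o a o' a' : ℕ} {σ : Fin o → OTerm L o'}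
    {τ : Fin a → ATerm L o' a'} (hσ : ∀ i, (σ i).sig ⊆ X) (hτ : ∀ i, (τ i).sig ⊆ X)
    {t : ATerm L o a} (ht : t.sig ⊆ X) : (t.subst σ τ).sig ⊆ X := by
  cases t with
  | var i => exact hτ i
  | fn A ts =>
    simp only [ATerm.sig, ATerm.subst, Set.union_subset_iff, Set.iUnion_subset_iff] at ht ⊢
    exact ⟨ht.1, fun i => OTerm.sig_subst_subset hσ (ht.2 i)⟩

theorem Fm.nsig_subst_subset {X : Set (Symb L)} {o a s : ℕ} {φ : Fm L o a s} :
    ∀ {o' a' s' : ℕ} {ρ : TSub L o a s o' a' s'}, (∀ i, (ρ.ob i).sig ⊆ X) →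
      (∀ i, (ρ.ac i).sig ⊆ X) → φ.nsig ⊆ X → (φ.subst ρ).nsig ⊆ X := by
  -- Shifting variables under a quantifier introduces no symbols.
  have hO : ∀ {n m : ℕ} (f : Fin n → Fin m), ∀ i, (OTerm.var (f i) : OTerm L m).sig ⊆ X :=
    fun _ _ => Set.empty_subset _
  have hA : ∀ {n m k : ℕ} (f : Fin n → Fin m), ∀ i, (ATerm.var (f i) : ATerm L k m).sig ⊆ X :=
    fun _ _ => Set.empty_subset _
  induction φ with
  | falsum => exact fun _ _ h => h
  | eqO t u =>
    intro _ _ _ ρ h₁ h₂ h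
    simp only [Fm.nsig, Set.union_subset_iff] at h
    exact Set.union_subset (OTerm.sig_subst_subset h₁ h.1) (OTerm.sig_subst_subset h₁ h.2)
  | eqA t u =>
    intro _ _ _ ρ h₁ h₂ h
    simp only [Fm.nsig, Set.union_subset_iff] at h
    exact Set.union_subset (ATerm.sig_subst_subset h₁ h₂ h.1) (ATerm.sig_subst_subset h₁ h₂ h.2)
  | eqS t u => exact fun _ _ h => h
  | pred P ts =>
    intro _ _ _ ρ h₁ h₂ h
    simp only [Fm.nsig, Fm.subst, Set.union_subset_iff, Set.iUnion_subset_iff] at h ⊢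
    exact ⟨h.1, fun i => OTerm.sig_subst_subset h₁ (h.2 i)⟩
  | flu F ts t =>
    intro _ _ _ ρ h₁ h₂ h
    simp only [Fm.nsig, Fm.subst, Set.union_subset_iff, Set.iUnion_subset_iff] at h ⊢
    exact ⟨h.1, fun i => OTerm.sig_subst_subset h₁ (h.2 i)⟩
  | poss b t => exact fun _ _ h => h
  | prec t u => exact fun _ _ h => h
  | imp φ ψ ih₁ ih₂ =>
    intro _ _ _ ρ h₁ h₂ h
    simp only [Fm.nsig, Set.union_subset_iff] at h
    exact Set.union_subset (ih₁ h₁ h₂ h.1) (ih₂ h₁ h₂ h.2)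
  | allO φ ih =>
    intro _ _ _ ρ h₁ h₂ h
    refine ih (ρ := ρ.underO) (fun i => ?_) (fun i => ?_) h
    · refine Fin.cases (Set.empty_subset _) (fun i => ?_) i
      exact OTerm.sig_subst_subset (hO Fin.succ) (h₁ i)
    · exact ATerm.sig_subst_subset (hO Fin.succ) (hA id) (h₂ i)
  | allA φ ih =>
    intro _ _ _ ρ h₁ h₂ h
    refine ih (ρ := ρ.underA) h₁ (fun i => ?_) h
    refine Fin.cases (Set.empty_subset _) (fun i => ?_) i
    exact ATerm.sig_subst_subset (hO id) (hA Fin.succ) (h₂ i)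
  | allS φ ih => exact fun h₁ h₂ h => ih (ρ := TSub.underS _) h₁ h₂ h

/-- Replacing both situation terms of a uniform formula by `S₀` leaves no other symbols of
situation terms. -/
theorem Fm.sig_replace_subset {X : Set (Symb L)} {S : STerm L 0 0 0} {o a s : ℕ}
    {φ : Fm L o a s} : ∀ {U : ∀ o a : ℕ, STerm L o a s → Prop}, φ.Uniform U →
      (∀ o a t, U o a t → STerm.replace .s0 S t = .s0) → φ.nsig ⊆ X →
      ((∃ F, Symb.flu F ∈ φ.nsig) → Symb.s0 ∈ X) → (φ.replace .s0 S).sig ⊆ X := by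
  induction φ with
  | falsum => exact fun _ _ h _ => h
  | eqO t u => exact fun _ _ h _ => h
  | eqA t u => exact fun _ _ h _ => h
  | eqS t u => exact fun h => h.elim
  | pred P ts => exact fun _ _ h _ => h
  | flu F ts t =>
    intro U hU H h h₀
    refine Set.union_subset h ?_
    rw [H _ _ t hU, STerm.sig, Set.singleton_subset_iff]
    exact h₀ ⟨F, Or.inl rfl⟩
  | poss b t => exact fun h => h.elim
  | prec t u => exact fun h => h.elim
  | imp φ ψ ih₁ ih₂ =>
    intro U hU H h h₀
    exact Set.union_subset
      (ih₁ hU.1 H (Set.subset_union_left.trans h) fun ⟨F, hF⟩ => h₀ ⟨F, Or.inl hF⟩)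
      (ih₂ hU.2 H (Set.subset_union_right.trans h) fun ⟨F, hF⟩ => h₀ ⟨F, Or.inr hF⟩)
  | allO φ ih => exact fun hU => ih hU
  | allA φ ih => exact fun hU => ih hU
  | allS φ ih => exact fun h => h.elim

/-- Uniformity forces the situation argument of a fluent to be S₀. So S₀ is already a symbol of any
initial component with a fluent, and the replacement of S_α by S₀ adds nothing new there. -/
theorem Fm.Uniform.s0_mem_sig {o a s : ℕ} {φ : Fm L o a s} {F : L.Flu} :
    φ.Uniform (fun _ _ t => t = .s0) → Symb.flu F ∈ φ.nsig → Symb.s0 ∈ φ.sig := by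
  have hO : ∀ {o : ℕ} (t : OTerm L o), Symb.flu F ∉ t.sig := by
    intro o t
    induction t with
    | var i => simp [OTerm.sig]
    | con c => simp [OTerm.sig]
    | fn f ts ih => simpa [OTerm.sig] using ih
  have hA : ∀ {o a : ℕ} (t : ATerm L o a), Symb.flu F ∉ t.sig := by
    intro o a t
    cases t with
    | var i => simp [ATerm.sig]
    | fn A ts => simp [ATerm.sig, hO]
  induction φ with
  | falsum => simp [Fm.nsig]
  | eqO t u => simp [Fm.nsig, hO]
  | eqA t u => simp [Fm.nsig, hA]
  | eqS t u => exact fun h => h.elim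
  | pred P ts => simp [Fm.nsig, hO]
  | flu F ts t =>
    rintro rfl -
    exact Or.inr rfl
  | poss b t => exact fun h => h.elim
  | prec t u => exact fun h => h.elim
  | imp φ ψ ih₁ ih₂ => exact fun hU h => h.imp (ih₁ hU.1) (ih₂ hU.2)
  | allO φ ih => exact fun hU h => ih hU h
  | allA φ ih => exact fun hU h => ih hU h
  | allS φ ih => exact fun h => h.elim

/-- The situation terms dropped by `Fm.nsig` are all S₀ here, and S₀ contains no fluent. -/
theorem Fm.flu_mem_nsig_of_uniform {o a s : ℕ} {φ : Fm L o a s} {F : L.Flu} :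
    φ.Uniform (fun _ _ t => t = .s0) → Symb.flu F ∈ φ.sig → Symb.flu F ∈ φ.nsig := by
  induction φ with
  | falsum => exact fun _ h => h
  | eqO t u => exact fun _ h => h
  | eqA t u => exact fun _ h => h
  | eqS t u => exact fun h => h.elim
  | pred P ts => exact fun _ h => h
  | flu F ts t =>
    rintro rfl (h | h)
    · exact h
    · simp [STerm.sig] at h
  | poss b t => exact fun h => h.elim
  | prec t u => exact fun h => h.elim
  | imp φ ψ ih₁ ih₂ => exact fun hU h => h.imp (ih₁ hU.1) (ih₂ hU.2)
  | allO φ ih => exact fun hU h => ih hU h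
  | allA φ ih => exact fun hU h => ih hU h
  | allS φ ih => exact fun h => h.elim

/-- The truth value of a formula depends only on the fluents that occur in it. -/
theorem Fm.realize_setFlu_congr (M : SCStr L Ob Ac Si)
    {k k' : (F : L.Flu) → (Fin (L.fluArity F) → Ob) → Si → Prop} {o a s : ℕ} (φ : Fm L o a s) :
    (∀ F, Symb.flu F ∈ φ.nsig → ∀ v s, k F v s ↔ k' F v s) → ∀ v w x,
      φ.Realize (M.setFlu k) v w x ↔ φ.Realize (M.setFlu k') v w x := by
  have hst : (M.setFlu k).SameStatic (M.setFlu k') := ⟨rfl, rfl, rfl, rfl⟩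
  have hS : ∀ {o a s : ℕ} (v : Fin o → Ob) (w : Fin a → Ac) (x : Fin s → Si)
      (t : STerm L o a s), t.eval (M.setFlu k) v w x = t.eval (M.setFlu k') v w x := by
    intro o a s v w x t
    induction t with
    | var i => rfl
    | s0 => rfl
    | doFn b t ih => exact congrArg₂ M.doFn (b.eval_congr hst v w) ih
  induction φ with
  | falsum => intros; rfl
  | eqO t u => intros; simp only [Fm.Realize, OTerm.eval_congr hst]
  | eqA t u => intros; simp only [Fm.Realize, ATerm.eval_congr hst]
  | eqS t u => intros; simp only [Fm.Realize, hS]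
  | pred P ts =>
    intros
    simp only [Fm.Realize, OTerm.eval_congr hst]
    rfl
  | flu F ts t =>
    intro h v w x
    simp only [Fm.Realize, OTerm.eval_congr hst, hS]
    exact h F (Or.inl rfl) _ _
  | poss b t =>
    intros
    simp only [Fm.Realize, ATerm.eval_congr hst, hS]
    rfl
  | prec t u =>
    intros
    simp only [Fm.Realize, hS]
    rfl
  | imp φ ψ ih₁ ih₂ =>
    intro h v w x
    exact imp_congr (ih₁ (fun F hF => h F (Or.inl hF)) v w x)
      (ih₂ (fun F hF => h F (Or.inr hF)) v w x)
  | allO φ ih => exact fun h v w x => forall_congr' fun d => ih h _ w x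
  | allA φ ih => exact fun h v w x => forall_congr' fun d => ih h v _ x
  | allS φ ih => exact fun h v w x => forall_congr' fun d => ih h v w _

/-! ## Valid sentences with a given symbol -/

/-- A valid sentence in which exactly the given symbol occurs. -/
def Symb.taut : Symb L → Sentence L
  | .doFn => .allS (.allA (.eqS (.doFn (.var 0) (.var 0)) (.doFn (.var 0) (.var 0))))
  | .prec => .allS (.imp (.prec (.var 0) (.var 0)) (.prec (.var 0) (.var 0)))
  | .s0 => .eqS .s0 .s0
  | .poss => .allS (.allA (.imp (.poss (.var 0) (.var 0)) (.poss (.var 0) (.var 0))))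
  | .act A => .allOs (L.actArity A) (.eqA (.fn A .var) (.fn A .var))
  | .flu F => .allS (.allOs (L.fluArity F) (.imp (.flu F .var (.var 0)) (.flu F .var (.var 0))))
  | .con c => .eqO (.con c) (.con c)
  | .pred P => .allOs (L.predArity P) (.imp (.pred P .var) (.pred P .var))
  | .fn f => .allOs (L.fnArity f) (.eqO (.fn f .var) (.fn f .var))

theorem Symb.sig_taut (x : Symb L) : x.taut.sig = {x} := by
  cases x <;> simp [Symb.taut, Fm.sig, Fm.sig_allOs, STerm.sig, ATerm.sig, OTerm.sig]

theorem Symb.realize_taut (x : Symb L) (M : SCStr L Ob Ac Si) :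
    x.taut.Realize M Fin.elim0 Fin.elim0 Fin.elim0 := by
  cases x <;> simp [Symb.taut, Fm.Realize, Fm.realize_allOs]

theorem Symb.models_taut (X : Set (Symb L)) (M : SCStr L Ob Ac Si) :
    M.Models (Symb.taut '' X) := by
  rintro _ ⟨x, -, rfl⟩
  exact x.realize_taut M

theorem Symb.sig_image_taut (X : Set (Symb L)) : Theory.sig (Symb.taut '' X) = X := by
  rw [Theory.sig, Set.biUnion_image]
  simp [Symb.sig_taut]

/-! ## Forgetting finitely many atoms -/

/-- `t̄ = d̄` for the arguments `d̄` of the ground atom `g`. -/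
def GAtom.eqArgs (g : GAtom L) {F : L.Flu} (h : g.flu = F) {o a s : ℕ}
    (ts : Fin (L.fluArity F) → OTerm L o) : Fm L o a s :=
  Fm.conj (List.ofFn fun p =>
    Fm.eqO (ts p) (.con (g.arg (Fin.cast (congrArg L.fluArity h.symm) p))))

open Classical in
/-- The formula in which the atom `g` has the truth value `b`. -/
noncomputable def Fm.setAtom (g : GAtom L) (b : Bool) : {o a s : ℕ} → Fm L o a s → Fm L o a s
  | _, _, _, .falsum => .falsum
  | _, _, _, .eqO t u => .eqO t u
  | _, _, _, .eqA t u => .eqA t u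
  | _, _, _, .eqS t u => .eqS t u
  | _, _, _, .pred P ts => .pred P ts
  | _, _, _, .flu F ts t =>
    if h : g.flu = F ∧ t = .s0 then
      cond b ((g.eqArgs h.1 ts).or (.flu F ts t)) ((g.eqArgs h.1 ts).neg.and (.flu F ts t))
    else .flu F ts t
  | _, _, _, .poss b t => .poss b t
  | _, _, _, .prec t u => .prec t u
  | _, _, _, .imp φ ψ => .imp (φ.setAtom g b) (ψ.setAtom g b)
  | _, _, _, .allO φ => .allO (φ.setAtom g b)
  | _, _, _, .allA φ => .allA (φ.setAtom g b)
  | _, _, _, .allS φ => .allS (φ.setAtom g b)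

/-- The structure in which the atom `g` has the truth value `b`. -/
def SCStr.setAtom (M : SCStr L Ob Ac Si) (g : GAtom L) (b : Bool) : SCStr L Ob Ac Si :=
  M.setFlu fun F v s => (M.Hit {g} F v ∧ s = M.s0 ∧ b = true) ∨
    (¬ (M.Hit {g} F v ∧ s = M.s0) ∧ M.flu F v s)

theorem GAtom.realize_eqArgs (g : GAtom L) {F : L.Flu} (h : g.flu = F) {o a s : ℕ}
    (ts : Fin (L.fluArity F) → OTerm L o) (M : SCStr L Ob Ac Si) (v : Fin o → Ob)
    (w : Fin a → Ac) (x : Fin s → Si) :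
    (g.eqArgs h ts : Fm L o a s).Realize M v w x ↔ M.Hit {g} F fun p => (ts p).eval M v := by
  subst h
  rw [GAtom.eqArgs, Fm.realize_conj, List.forall_mem_ofFn_iff]
  constructor
  · exact fun h => ⟨g.arg, rfl, funext h⟩
  · rintro ⟨t, ht, h⟩ p
    obtain rfl : t = g.arg := by
      cases g
      cases ht
      rfl
    exact congrFun h p

/-- Arguments are compared with those of g by equations inside the formula, so no unique names are
needed. The syntax recognises S₀ only as a literal term; the assumption that every other allowed
situation term denotes something else makes it agree with the semantic change at S₀. -/
theorem Fm.realize_setAtom (M : SCStr L Ob Ac Si) (g : GAtom L) (b : Bool) {o a s : ℕ}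
    (φ : Fm L o a s) : ∀ (U : ∀ o a : ℕ, STerm L o a s → Prop) (x : Fin s → Si), φ.Uniform U →
      (∀ o a t, U o a t → t = .s0 ∨ ∀ v w, t.eval M v w x ≠ M.s0) → ∀ v w,
      (φ.setAtom g b).Realize M v w x ↔ φ.Realize (M.setAtom g b) v w x := by
  have hst : (M.setAtom g b).SameStatic M := ⟨rfl, rfl, rfl, rfl⟩
  have hS : ∀ {o a s : ℕ} (v : Fin o → Ob) (w : Fin a → Ac) (x : Fin s → Si)
      (t : STerm L o a s), t.eval (M.setAtom g b) v w x = t.eval M v w x := by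
    intro o a s v w x t
    induction t with
    | var i => rfl
    | s0 => rfl
    | doFn b t ih => exact congrArg₂ M.doFn (b.eval_congr hst v w) ih
  induction φ with
  | falsum => intros; rfl
  | eqO t u => intros; simp only [Fm.setAtom, Fm.Realize, OTerm.eval_congr hst]
  | eqA t u => intros; simp only [Fm.setAtom, Fm.Realize, ATerm.eval_congr hst]
  | eqS t u => intro U x hU; exact hU.elim
  | pred P ts => intros; simp only [Fm.setAtom, Fm.Realize, OTerm.eval_congr hst]; rfl
  | flu F ts t =>
    intro U x hU H v w
    have hR : (Fm.flu F ts t).Realize (M.setAtom g b) v w x ↔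
        (M.Hit {g} F (fun p => (ts p).eval M v) ∧ t.eval M v w x = M.s0 ∧ b = true) ∨
        (¬ (M.Hit {g} F (fun p => (ts p).eval M v) ∧ t.eval M v w x = M.s0) ∧
          M.flu F (fun p => (ts p).eval M v) (t.eval M v w x)) := by
      simp only [Fm.Realize, OTerm.eval_congr hst, hS]
      rfl
    rw [hR, Fm.setAtom]
    split_ifs with h
    · obtain ⟨h, rfl⟩ := h
      have h₀ : (STerm.s0 : STerm L _ _ _).eval M v w x = M.s0 := rfl
      cases b
      · simp [GAtom.realize_eqArgs, h₀, Fm.Realize]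
      · simp only [cond_true, Fm.realize_or, GAtom.realize_eqArgs, h₀, Fm.Realize]
        tauto
    · have hn : ¬ (M.Hit {g} F (fun p => (ts p).eval M v) ∧ t.eval M v w x = M.s0) := by
        rintro ⟨⟨d, hd, -⟩, h₀⟩
        rcases H _ _ t hU with rfl | hne
        · refine h ⟨?_, rfl⟩
          rw [← Set.mem_singleton_iff.1 hd]
        · exact hne v w h₀
      simp only [Fm.Realize]
      tauto
  | poss b t => intro U x hU; exact hU.elim
  | prec t u => intro U x hU; exact hU.elim
  | imp φ ψ ih₁ ih₂ =>
    intro U x hU H v w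
    exact imp_congr (ih₁ U x hU.1 H v w) (ih₂ U x hU.2 H v w)
  | allO φ ih => exact fun U x hU H v w => forall_congr' fun d => ih U x hU H _ w
  | allA φ ih => exact fun U x hU H v w => forall_congr' fun d => ih U x hU H v _
  | allS φ ih => intro U x hU; exact hU.elim

theorem GAtom.eqArgs_uniform (g : GAtom L) {F : L.Flu} (h : g.flu = F) {o a s : ℕ}
    (ts : Fin (L.fluArity F) → OTerm L o) {U : ∀ o a : ℕ, STerm L o a s → Prop} :
    (g.eqArgs h ts : Fm L o a s).Uniform U :=
  Fm.Uniform.conj (List.forall_mem_ofFn_iff.2 fun _ => by simp only [Fm.Uniform])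

theorem GAtom.nsig_eqArgs_subset {X : Set (Symb L)} {g : GAtom L}
    (hg : ∀ p, Symb.con (g.arg p) ∈ X) {F : L.Flu} (h : g.flu = F) {o a s : ℕ}
    {ts : Fin (L.fluArity F) → OTerm L o} (hts : ∀ p, (ts p).sig ⊆ X) :
    (g.eqArgs h ts : Fm L o a s).nsig ⊆ X := by
  rw [GAtom.eqArgs, Fm.nsig_conj, Set.iUnion₂_subset_iff, List.forall_mem_ofFn_iff]
  exact fun p => Set.union_subset (hts p) (Set.singleton_subset_iff.2 (hg _))

theorem Fm.Uniform.setAtom (g : GAtom L) (b : Bool) {o a s : ℕ} {φ : Fm L o a s} :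
    ∀ {U : ∀ o a : ℕ, STerm L o a s → Prop}, φ.Uniform U → (φ.setAtom g b).Uniform U := by
  induction φ with
  | falsum => exact fun h => h
  | eqO t u => exact fun h => h
  | eqA t u => exact fun h => h
  | eqS t u => exact fun h => h
  | pred P ts => exact fun h => h
  | flu F ts t =>
    intro U hU
    rw [Fm.setAtom]
    split_ifs with h
    · have hE := fun a => g.eqArgs_uniform h.1 ts (a := a) (U := U)
      have hF : (Fm.flu F ts t).Uniform U := hU
      cases b
      · exact (hE _).neg.and hF
      · exact (hE _).or hF
    · exact hU
  | poss b t => exact fun h => h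
  | prec t u => exact fun h => h
  | imp φ ψ ih₁ ih₂ => exact fun h => ⟨ih₁ h.1, ih₂ h.2⟩
  | allO φ ih => exact fun h => ih h
  | allA φ ih => exact fun h => ih h
  | allS φ ih => exact fun h => h

theorem Fm.nsig_setAtom_subset {X : Set (Symb L)} {g : GAtom L} (hg : ∀ p, Symb.con (g.arg p) ∈ X)
    (b : Bool) {o a s : ℕ} {φ : Fm L o a s} : φ.nsig ⊆ X → (φ.setAtom g b).nsig ⊆ X := by
  induction φ with
  | falsum => exact fun h => h
  | eqO t u => exact fun h => h
  | eqA t u => exact fun h => h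
  | eqS t u => exact fun h => h
  | pred P ts => exact fun h => h
  | flu F ts t =>
    intro hX
    rw [Fm.setAtom]
    split_ifs with h
    · have hE := fun a s => GAtom.nsig_eqArgs_subset hg h.1 (ts := ts) (a := a) (s := s)
        (Set.iUnion_subset_iff.1 (Set.subset_union_right.trans hX))
      cases b
      · simp only [cond_false, Fm.nsig_and, Fm.nsig_neg]
        exact Set.union_subset (hE _ _) hX
      · simp only [cond_true, Fm.nsig_or]
        exact Set.union_subset (hE _ _) hX
    · exact hX
  | poss b t => exact fun h => h
  | prec t u => exact fun h => h
  | imp φ ψ ih₁ ih₂ =>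
    intro h
    simp only [Fm.nsig, Set.union_subset_iff] at h
    exact Set.union_subset (ih₁ h.1) (ih₂ h.2)
  | allO φ ih => exact ih
  | allA φ ih => exact ih
  | allS φ ih => exact ih

/-- The result of forgetting a list of atoms in a sentence. -/
noncomputable def Fm.forgetAtoms (φ : Sentence L) : List (GAtom L) → Sentence L
  | [] => φ
  | g :: l => ((Fm.forgetAtoms φ l).setAtom g true).or ((Fm.forgetAtoms φ l).setAtom g false)

theorem Fm.Uniform.forgetAtoms {φ : Sentence L} {U : ∀ o a : ℕ, STerm L o a 0 → Prop}
    (h : φ.Uniform U) (l : List (GAtom L)) : (φ.forgetAtoms l).Uniform U := by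
  induction l with
  | nil => exact h
  | cons g l ih => exact (ih.setAtom g true).or (ih.setAtom g false)

theorem Fm.nsig_forgetAtoms_subset {X : Set (Symb L)} {φ : Sentence L} (h : φ.nsig ⊆ X)
    {l : List (GAtom L)} (hl : ∀ g ∈ l, ∀ p, Symb.con (g.arg p) ∈ X) :
    (φ.forgetAtoms l).nsig ⊆ X := by
  induction l with
  | nil => exact h
  | cons g l ih =>
    rw [List.forall_mem_cons] at hl
    rw [Fm.forgetAtoms, Fm.nsig_or]
    exact Set.union_subset (Fm.nsig_setAtom_subset hl.1 _ (ih hl.2))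
      (Fm.nsig_setAtom_subset hl.1 _ (ih hl.2))

/-- The disjunction at each stage guesses the truth value of one atom; the remaining atoms are then
forgotten in the structure altered by that guess. -/
theorem Fm.realize_forgetAtoms {α : GroundAction L} {φ : Sentence L}
    (hφ : φ.Uniform fun _ _ t => t = STerm.s0.lift ∨ t = α.sit.lift) (l : List (GAtom L)) :
    ∀ M : SCStr L Ob Ac Si, M.s0 ≠ M.sit α.sit →
      ((φ.forgetAtoms l).Realize M Fin.elim0 Fin.elim0 Fin.elim0 ↔
        ∃ k, φ.Realize (M.setFlu k) Fin.elim0 Fin.elim0 Fin.elim0 ∧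
          ∀ F v s, ¬ (M.Hit {g | g ∈ l} F v ∧ s = M.s0) → (k F v s ↔ M.flu F v s)) := by
  induction l with
  | nil =>
    intro M _
    constructor
    · exact fun h => ⟨M.flu, h, fun _ _ _ _ => Iff.rfl⟩
    · rintro ⟨k, hk, h⟩
      refine (φ.realize_setFlu_congr M (fun F _ v s => h F v s ?_) _ _ _).1 hk
      rintro ⟨⟨t, ht, -⟩, -⟩
      exact List.not_mem_nil ht
  | cons g l ih =>
    intro M hM
    have hset : ∀ b, ((φ.forgetAtoms l).setAtom g b).Realize M Fin.elim0 Fin.elim0 Fin.elim0 ↔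
        ∃ k, φ.Realize (M.setFlu k) Fin.elim0 Fin.elim0 Fin.elim0 ∧
          ∀ F v s, ¬ (M.Hit {g | g ∈ l} F v ∧ s = M.s0) →
            (k F v s ↔ (M.setAtom g b).flu F v s) := fun b => by
      refine (Fm.realize_setAtom M g b _ _ _ (hφ.forgetAtoms l) ?_ _ _).trans
        (ih (M.setAtom g b) hM)
      rintro o a t (rfl | rfl)
      · exact Or.inl rfl
      · refine Or.inr fun v w => ?_
        rw [STerm.eval_lift]
        exact hM.symm
    have hcons : ∀ F v, M.Hit {g' | g' ∈ g :: l} F v ↔ M.Hit {g} F v ∨ M.Hit {g | g ∈ l} F v :=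
      fun F v => by
        simp only [SCStr.Hit, Set.mem_ofPred_eq, List.mem_cons, Set.mem_singleton_iff, or_and_right,
          exists_or]
    rw [Fm.forgetAtoms, Fm.realize_or, hset, hset]
    constructor
    · rintro (⟨k, hk, h⟩ | ⟨k, hk, h⟩) <;>
      · refine ⟨k, hk, fun F v s hs => ?_⟩
        rw [hcons] at hs
        rw [h F v s (by tauto)]
        simp only [SCStr.setAtom, SCStr.setFlu]
        tauto
    · rintro ⟨k, hk, h⟩
      -- The single atom g denotes one fluent at one tuple, so `k` gives it one truth value, and
      -- that value selects the disjunct.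
      have hone : ∀ F v, M.Hit {g} F v →
          (k F v M.s0 ↔ k g.flu (fun p => M.con (g.arg p)) M.s0) := by
        rintro F _ ⟨t, rfl, rfl⟩
        rfl
      have main : ∀ b : Bool, (b = true ↔ k g.flu (fun p => M.con (g.arg p)) M.s0) →
          ∀ F v s, ¬ (M.Hit {g | g ∈ l} F v ∧ s = M.s0) →
            (k F v s ↔ (M.setAtom g b).flu F v s) := by
        intro b hb F v s hs
        simp only [SCStr.setAtom, SCStr.setFlu]
        by_cases hg : M.Hit {g} F v ∧ s = M.s0
        · obtain ⟨hg, rfl⟩ := hg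
          rw [hone F v hg, ← hb]
          simp [hg]
        · rw [h F v s (by rw [hcons]; tauto)]
          tauto
      by_cases hb : k g.flu (fun p => M.con (g.arg p)) M.s0
      · exact Or.inl ⟨k, hk, main true (by simp [hb])⟩
      · exact Or.inr ⟨k, hk, main false (by simp [hb])⟩

/-- Finitely many atoms can be forgotten in a finite theory, without new symbols. -/
theorem exists_isForget {α : GroundAction L} {T : Theory L} (hfin : T.Finite)
    (hT : T.UniformIn₂ .s0 α.sit) {Ω : Set (GAtom L)} (hΩ : Ω.Finite) {X : Set (Symb L)}
    (hTX : ∀ φ ∈ T, Fm.nsig φ ⊆ X) (hΩX : ∀ g ∈ Ω, ∀ p, Symb.con (g.arg p) ∈ X) :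
    ∃ G : Theory L, G.UniformIn₂ .s0 α.sit ∧ IsForget α T Ω G ∧ ∀ φ ∈ G, Fm.nsig φ ⊆ X := by
  -- One choice of truth values must serve all sentences at once, so the finite theory is first
  -- merged into a single sentence.
  set φ : Sentence L := Fm.conj hfin.toFinset.toList with hφ
  have hφU : φ.Uniform fun _ _ t => t = STerm.s0.lift ∨ t = α.sit.lift :=
    Fm.Uniform.conj fun ψ hψ => hT ψ (by simpa using hψ)
  refine ⟨{φ.forgetAtoms hΩ.toFinset.toList}, ?_, ?_, ?_⟩
  · rintro _ rfl
    exact hφU.forgetAtoms _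
  · intro Ob Ac Si _ _ _ M hM
    have hmem : {g | g ∈ hΩ.toFinset.toList} = Ω := by
      ext
      simp
    have hmod : ∀ N : SCStr L Ob Ac Si, N.Models T ↔
        φ.Realize N Fin.elim0 Fin.elim0 Fin.elim0 := fun N => by
      simp [hφ, SCStr.Models]
    rw [SCStr.exists_simOff_iff]
    simp only [SCStr.Models, Set.mem_singleton_iff, forall_eq, Fm.realize_forgetAtoms hφU _ M hM,
      hmem]
    exact exists_congr fun k => and_congr_left fun _ => (hmod _).symm
  · rintro _ rfl
    refine Fm.nsig_forgetAtoms_subset ?_ fun g hg => hΩX g (by simpa using hg)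
    rw [hφ, Fm.nsig_conj, Set.iUnion₂_subset_iff]
    exact fun ψ hψ => hTX ψ (by simpa using hψ)

/-! ## Instantiated successor state axioms -/

theorem Fm.Uniform.subst_s0 {o a s : ℕ} {φ : Fm L o a s} :
    ∀ {o' a' s' : ℕ} {ρ : TSub L o a s o' a' s'} {U : ∀ o a : ℕ, STerm L o a s → Prop}
      {U' : ∀ o a : ℕ, STerm L o a s' → Prop}, φ.Uniform U →
      (∀ o a t, U o a t → ∃ i, t = .var i) → (∀ i, ρ.si i = .s0) → (∀ o a, U' o a .s0) →
      (φ.subst ρ).Uniform U' := by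
  induction φ with
  | falsum => exact fun _ _ _ _ => trivial
  | eqO t u => exact fun _ _ _ _ => trivial
  | eqA t u => exact fun _ _ _ _ => trivial
  | eqS t u => exact fun h => h.elim
  | pred P ts => exact fun _ _ _ _ => trivial
  | flu F ts t =>
    intro _ _ _ ρ U U' h hU hρ hU'
    obtain ⟨i, rfl⟩ := hU _ _ t h
    simp only [Fm.subst, STerm.subst, hρ]
    exact hU' _ _
  | poss b t => exact fun h => h.elim
  | prec t u => exact fun h => h.elim
  | imp φ ψ ih₁ ih₂ => exact fun h hU hρ hU' => ⟨ih₁ h.1 hU hρ hU', ih₂ h.2 hU hρ hU'⟩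
  | allO φ ih =>
    intro _ _ _ ρ U U' h hU hρ hU'
    exact ih (ρ := ρ.underO) h hU (fun i => by simp [TSub.underO, hρ, STerm.subst]) hU'
  | allA φ ih =>
    intro _ _ _ ρ U U' h hU hρ hU'
    exact ih (ρ := ρ.underA) h hU (fun i => by simp [TSub.underA, hρ, STerm.subst]) hU'
  | allS φ ih => exact fun h => h.elim

theorem Effect.inst_uniformInVar {n : ℕ} (α : GroundAction L) (e : Effect L n) :
    (e.inst α).UniformInVar := by
  rw [Effect.inst]
  split_ifs with h
  · exact Fm.Uniform.exOs ((Fm.Uniform.conj (List.forall_mem_ofFn_iff.2 fun _ => by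
      simp only [Fm.Uniform])).and e.ctx_uniform)
  · exact trivial

/-- Trading a = B(t̄) for c̄ = t̄ can add only the constants of α, which is why Δ has to contain
them. -/
theorem Effect.nsig_inst_subset {X : Set (Symb L)} {α : GroundAction L} (hα : α.constants ⊆ X)
    {n : ℕ} {e : Effect L n} (he : e.toFm.nsig ⊆ X) : (e.inst α).nsig ⊆ X := by
  rw [Effect.toFm, Fm.nsig_exOs, Fm.nsig_and, Set.union_subset_iff] at he
  obtain ⟨h₁, h₂⟩ := he
  simp only [Fm.nsig, ATerm.sig, Set.union_subset_iff, Set.iUnion_subset_iff] at h₁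
  rw [Effect.inst]
  split_ifs with h
  · rw [Fm.nsig_exOs, Fm.nsig_and, Fm.nsig_conj]
    refine Set.union_subset ?_ ((e.ctx.nsig_subset_nsig_subst _).trans h₂)
    rw [Set.iUnion₂_subset_iff, List.forall_mem_ofFn_iff]
    exact fun q => Set.union_subset (Set.singleton_subset_iff.2 (hα ⟨_, rfl⟩)) (h₁.2.2 q)
  · exact Set.empty_subset _

namespace BAT

variable (D : BAT L) (α : GroundAction L)

theorem instSentence_uniform (g : GAtom L) :
    (D.instSentence α g).Uniform fun _ _ t => t = STerm.s0.lift ∨ t = α.sit.lift := by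
  have key : ∀ l : List (Effect L (L.fluArity g.flu)),
      ((Fm.disj (l.map (Effect.inst α))).subst
        (⟨fun p => .con (g.arg p), Fin.elim0, fun _ => .s0⟩ : TSub L _ 0 1 0 0 0)).Uniform
        fun _ _ t => t = STerm.s0.lift ∨ t = α.sit.lift := fun l => by
    refine Fm.Uniform.subst_s0 (U := fun _ _ t => t = .var 0) (Fm.Uniform.disj ?_)
      (fun _ _ t ht => ⟨0, ht⟩) (fun _ => rfl) fun _ _ => Or.inl rfl
    simp only [List.mem_map, forall_exists_index, and_imp, forall_apply_eq_imp_iff₂]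
    exact fun e _ => e.inst_uniformInVar α
  refine Fm.Uniform.iff (Or.inr ?_) ((key _).or (Fm.Uniform.and (Or.inl rfl) (key _).neg))
  simp [GroundAction.sit, STerm.lift, STerm.subst, ATerm.subst, OTerm.subst]

theorem nsig_instSentence_subset {X : Set (Symb L)} (hα : α.constants ⊆ X) {g : GAtom L}
    (hg : ∀ p, Symb.con (g.arg p) ∈ X) (hssa : (D.ssaSentence g.flu).nsig ⊆ X) :
    (D.instSentence α g).nsig ⊆ X := by
  simp only [ssaSentence, Fm.nsig_iff, Fm.nsig_or, Fm.nsig_and, Fm.nsig_neg, Fm.nsig_allOs,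
    Fm.nsig_disj, Fm.nsig, Set.union_subset_iff, Set.iUnion₂_subset_iff, List.mem_map,
    forall_exists_index, and_imp, forall_apply_eq_imp_iff₂] at hssa
  obtain ⟨⟨hF, -⟩, hpos, -, hneg⟩ := hssa
  have key : ∀ l : List (Effect L (L.fluArity g.flu)), (∀ e ∈ l, e.toFm.nsig ⊆ X) →
      ((Fm.disj (l.map (Effect.inst α))).subst
        (⟨fun p => .con (g.arg p), Fin.elim0, fun _ => .s0⟩ : TSub L _ 0 1 0 0 0)).nsig ⊆ X :=
    fun l hl => by
      refine Fm.nsig_subst_subset (fun i => Set.singleton_subset_iff.2 (hg i))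
        (fun i => i.elim0) ?_
      simp only [Fm.nsig_disj, Set.iUnion₂_subset_iff, List.mem_map, forall_exists_index, and_imp,
        forall_apply_eq_imp_iff₂]
      exact fun e he => Effect.nsig_inst_subset hα (hl e he)
  simp only [instSentence, Fm.nsig_iff, Fm.nsig_or, Fm.nsig_and, Fm.nsig_neg]
  have hat : ∀ t : STerm L 0 0 0,
      (Fm.flu g.flu (fun p => .con (g.arg p)) t : Sentence L).nsig ⊆ X := fun t =>
    Set.union_subset hF (Set.iUnion_subset fun p => Set.singleton_subset_iff.2 (hg p))
  exact Set.union_subset (hat _) (Set.union_subset (key _ hpos)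
    (Set.union_subset (hat _) (key _ hneg)))

theorem flu_mem_nsig_ssaSentence (F : L.Flu) : Symb.flu F ∈ (D.ssaSentence F).nsig := by
  simp only [ssaSentence, Fm.nsig_iff, Fm.nsig, Fm.nsig_allOs]
  exact Or.inl (Or.inl rfl)

variable {D α}

theorem con_arg_mem_of_mem_omega {g : GAtom L} (hg : g ∈ D.omega α)
    (p : Fin (L.fluArity g.flu)) : Symb.con (g.arg p) ∈ α.constants := by
  obtain ⟨e, -, h, H⟩ := hg
  obtain ⟨q, -, hq⟩ := H p
  exact ⟨_, congrArg Symb.con hq.symm⟩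

variable (D α)

/-- The arguments of atoms in Ω are among the finitely many arguments of α. A finite component has
finitely many fluents, hence finitely many atoms to forget. -/
theorem omega_finite {S : Set L.Flu} (hS : S.Finite) : {g ∈ D.omega α | g.flu ∈ S}.Finite := by
  refine (hS.biUnion fun F _ => (Set.Finite.pi' (ι := Fin (L.fluArity F))
    fun _ => Set.finite_range α.arg).image fun t => (⟨F, t⟩ : GAtom L)).subset ?_
  rintro ⟨F, t⟩ ⟨hg, hF⟩
  refine Set.mem_biUnion hF ⟨t, fun p => ?_, rfl⟩
  obtain ⟨q, hq⟩ := con_arg_mem_of_mem_omega hg p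
  exact ⟨q, Symb.con.inj hq⟩

end BAT

/-- Forgetting in a union of theories with disjoint sets of fluents: the theory `T j` has only the
fluents from the class `j` of the partition `c` of all fluents. -/
theorem IsForget.iUnion {J : Type*} {α : GroundAction L} {T : J → Theory L} {Ω : Set (GAtom L)}
    {G : J → Theory L} (c : L.Flu → J) (hT : ∀ j, ∀ φ ∈ T j, ∀ F, Symb.flu F ∈ Fm.nsig φ → c F = j)
    (hG : ∀ j, IsForget α (T j) {g ∈ Ω | c g.flu = j} (G j)) :
    IsForget α (⋃ j, T j) Ω (⋃ j, G j) := by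
  intro Ob Ac Si _ _ _ M hM
  have hG' := fun j => hG j Ob Ac Si M hM
  simp only [SCStr.exists_simOff_iff] at hG' ⊢
  simp only [SCStr.models_iUnion, hG']
  have hcong : ∀ j k k', (∀ F, c F = j → ∀ v s, k F v s ↔ k' F v s) →
      ((M.setFlu k).Models (T j) ↔ (M.setFlu k').Models (T j)) := fun j k k' h =>
    forall₂_congr fun φ hφ => φ.realize_setFlu_congr M (fun F hF => h F (hT j φ hφ F hF)) _ _ _
  constructor
  · intro h
    choose k hk hoff using h
    -- The separate witnesses are glued: each fluent is taken from the witness of its own class, the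
    -- only one whose theory can see it.
    refine ⟨fun F => k (c F) F, fun j => ?_, fun F v s hs => hoff (c F) F v s ?_⟩
    · refine (hcong j _ _ fun F hF v s => ?_).1 (hk j)
      rw [hF]
    · exact fun ⟨⟨t, ht, hv⟩, hs'⟩ => hs ⟨⟨t, ht.1, hv⟩, hs'⟩
  · rintro ⟨k, hk, hoff⟩ j
    -- The common witness is used on class j only; elsewhere the fluents of `M` are restored, as
    -- only atoms of class j may change.
    refine ⟨fun F v s => (c F = j ∧ k F v s) ∨ (c F ≠ j ∧ M.flu F v s), ?_, fun F v s hs => ?_⟩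
    · refine (hcong j _ _ fun F hF v s => ?_).1 (hk j)
      simp [hF]
    · by_cases hF : c F = j
      · simp only [hF, true_and, ne_eq, not_true, false_and, or_false]
        refine hoff F v s fun ⟨⟨t, ht, hv⟩, hs'⟩ => hs ⟨⟨t, ⟨ht, hF⟩, hv⟩, hs'⟩
      · simp [hF]

theorem IsForget.of_equiv {α : GroundAction L} {T T' : Theory L} {Ω : Set (GAtom L)}
    {G : Theory L} (h : IsForget α T Ω G) (hT : T.Equiv T') : IsForget α T' Ω G := by
  intro Ob Ac Si _ _ _ M hM
  simp only [h Ob Ac Si M hM, fun N : SCStr L Ob Ac Si => hT Ob Ac Si N]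

/-! ## Preservation of components -/

/-- An update preserves the consequences without fluents. -/
theorem BAT.IsUpdate.cons_eq {D : BAT L} {α : GroundAction L} {T Q : Theory L} {Ω : Set (GAtom L)}
    (hT : T.UniformIn .s0) (hQ : D.IsUpdate α T Ω Q) {Δ : Set (Symb L)} (hΔ : FluentFree Δ) :
    Q.Cons Δ = T.Cons Δ := by
  ext φ
  refine and_congr_left fun hφ => ?_
  have hφ' : ∀ F, Symb.flu F ∉ φ.nsig := fun F h => hΔ F (hφ (φ.nsig_subset_sig h))
  constructor
  · intro h Ob Ac Si _ _ _ M hM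
    -- The state of a model of `T` can always be updated, over the same domains and static symbols;
    -- φ does not notice the new fluents.
    have hU := h Ob Ac Si (M.withFlu (D.Updated α Ω M fun F v => M.flu F v M.s0))
      ((hQ.models_iff hT _).2 ⟨fun F v => M.flu F v M.s0,
        (hT.models_congr (M := M) (N := M.withFlu fun F v => M.flu F v M.s0) ⟨rfl, rfl, rfl, rfl⟩
          fun F v => Iff.rfl).1 hM,
        fun F v => Iff.rfl⟩)
    exact (φ.realize_setFlu_congr M (fun F hF => absurd hF (hφ' F)) _ _ _).1 hU
  · intro h Ob Ac Si _ _ _ M hM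
    obtain ⟨f, hf, -⟩ := (hQ.models_iff hT M).1 hM
    exact (φ.realize_setFlu_congr M (fun F hF => absurd hF (hφ' F)) _ _ _).1 (h Ob Ac Si _ hf)

/-- A result of forgetting gives an update, moved to `S_α`. -/
theorem BAT.exists_isLocalEffectProgression {D : BAT L} {α : GroundAction L} {G : Theory L}
    (hG : G.UniformIn₂ .s0 α.sit)
    (hforget : IsForget α (D.inst α (D.omega α) ∪ D.init) (D.omega α) G) :
    D.IsLocalEffectProgression α ((G.replace .s0 α.sit).replace α.sit .s0) := by
  have hU : ∀ φ ∈ G, (Fm.replace .s0 α.sit φ).Uniform fun _ _ t => t = STerm.s0.lift :=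
    fun φ hφ => (hG φ hφ).replace fun o a t ht => α.replace_eq_s0 ht
  refine ⟨?_, G, hG, hforget, ?_⟩
  · rintro _ ⟨_, ⟨φ, hφ, rfl⟩, rfl⟩
    refine (hU φ hφ).replace ?_
    rintro o a t rfl
    exact STerm.replace_lift _ _
  · have : ((G.replace .s0 α.sit).replace α.sit .s0).replace .s0 α.sit = G.replace .s0 α.sit := by
      simp only [Theory.replace, Set.image_image]
      exact Set.image_congr fun φ hφ => Fm.replace_replace (hU φ hφ)
    rw [this]
    exact fun _ _ _ _ _ _ _ => Iff.rfl

end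

/-- The crux is to track symbols: the successor state axioms of the fluents of one component must
not bring in, outside Δ, symbols of another. The sets `B j` collect all that can enter the j-th new
component apart from Δ. -/
theorem mainTheorem1 {L : SCLang} (D : BAT L) (hD : D.LocalEffect) (α : GroundAction L)
    (Δ₁ Δ₂ Δ : Set (Symb L)) (hΔ₁ : FluentFree Δ₁) (hΔ₂ : FluentFree Δ₂)
    (hdo₁ : Symb.doFn ∉ Δ₁) (hdo₂ : Symb.doFn ∉ Δ₂) (hΔ : Δ = Δ₁ ∪ Δ₂ ∪ α.constants)
    {I J : Type*} [Nonempty I] (Dss : I → Theory L) (D' : J → Theory L)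
    -- the groups of successor state axioms
    (hss : ⋃ i, Dss i = D.ssaTheory)
    (hss_sig : ∀ n m, n ≠ m → (Dss n).sig ∩ (Dss m).sig ⊆ Δ₁ ∪ {Symb.doFn})
    -- the components of the initial theory
    (hdec : IsDecomposition Δ₂ D.init D') (hfin : ∀ j, (D' j).Finite)
    (hunif : ∀ j, (D' j).UniformIn .s0) (hne : ∀ j, ((D' j).sig \ Δ).Nonempty)
    -- the alignment conditions
    (hflu : D.ssaTheory.sig ∩ Set.range Symb.flu ⊆ D.init.sig)
    (halign : ∀ i, ∃ j, (Dss i).sig ∩ D.init.sig ⊆ (D' j).sig) :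
    (∃ P : Theory L, D.IsLocalEffectProgression α P) ∧
    ∀ P : Theory L, D.IsLocalEffectProgression α P →
      D.IsProgression α P ∧
      -- `P(S₀/S_α)`, with valid sentences added in order that all symbols occur, is decomposable
      ∃ (V : Theory L) (D'' : J → Theory L), (∀ φ ∈ V, Sentence.Valid φ) ∧
        IsDecomposition Δ (P.replace .s0 α.sit ∪ V) D'' ∧
        -- the `j`-th component corresponds to the `j`-th component of the initial theory
        (∀ j, D.IsUpdate α (D' j) {g ∈ D.omega α | Symb.flu g.flu ∈ (D' j).sig} (D'' j)) ∧
        ((∀ i j, i ≠ j → DeltaInseparable Δ (D' i) (D' j)) →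
          ∀ i j, i ≠ j → DeltaInseparable Δ (D'' i) (D'' j)) := by
  have hΔ_flu : FluentFree Δ := by
    subst hΔ
    rintro F ((h | h) | ⟨q, hq⟩)
    · exact hΔ₁ F h
    · exact hΔ₂ F h
    · cases hq
  have hconst : α.constants ⊆ Δ := hΔ ▸ Set.subset_union_right
  -- every fluent occurs in exactly one component
  have hown : ∀ F, ∃ j, Symb.flu F ∈ (D' j).sig := fun F => by
    have : Symb.flu F ∈ D.init.sig := hflu
      ⟨Theory.subset_sig (Set.mem_range_self F) (Fm.nsig_subset_sig _ (D.flu_mem_nsig_ssaSentence F)), F, rfl⟩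
    rwa [← hdec.union, Set.mem_iUnion] at this
  choose c hc using hown
  have hcu : ∀ F j, Symb.flu F ∈ (D' j).sig → c F = j := fun F j h => by
    by_contra hne
    exact hΔ₂ F ((hdec.inter _ _ hne).subset ⟨hc F, h⟩)
  have hinit : ∀ j, (D' j).sig ⊆ D.init.sig := fun j =>
    hdec.union ▸ Set.subset_iUnion (fun j => (D' j).sig) j
  have hgroup : ∀ F, ∃ i, (D.ssaSentence F).nsig ⊆ (Dss i).sig := fun F => by
    have : D.ssaSentence F ∈ ⋃ i, Dss i := hss.symm ▸ Set.mem_range_self F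
    obtain ⟨i, hi⟩ := Set.mem_iUnion.1 this
    exact ⟨i, (Fm.nsig_subset_sig _).trans (Theory.subset_sig hi)⟩
  choose grp hgrp using hgroup
  -- Alignment only promises some component; `F` itself is a shared symbol of its group and the
  -- initial theory, so that component must be the one owning `F`.
  have hgrp_align : ∀ F, (Dss (grp F)).sig ∩ D.init.sig ⊆ (D' (c F)).sig := fun F => by
    obtain ⟨j, hj⟩ := halign (grp F)
    obtain rfl := hcu F j (hj ⟨hgrp F (D.flu_mem_nsig_ssaSentence F), hinit _ (hc F)⟩)
    exact hj
  -- the symbols of the components and of the successor state axioms of their fluents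
  set B : J → Set (Symb L) := fun j =>
    {x | x ∈ (D' j).sig ∨ ∃ F, c F = j ∧ x ∈ (D.ssaSentence F).nsig} with hB
  have hB_init : ∀ j x, x ∈ B j → x ∈ D.init.sig → x ∈ (D' j).sig := by
    rintro j x (h | ⟨F, rfl, h⟩) hx
    · exact h
    · exact hgrp_align F ⟨hgrp F h, hx⟩
  have hB_flu : ∀ j F, Symb.flu F ∈ B j → Symb.flu F ∈ (D' j).sig := fun j F h =>
    hB_init j _ h (hinit _ (hc F))
  -- A common symbol of the initial theory lies in both old components, hence in Δ₂. Any other one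
  -- comes from two successor state axioms.
  have hB_inter : ∀ i j, i ≠ j → B i ∩ B j ⊆ Δ := by
    intro i j hij x hx
    by_cases hxi : x ∈ D.init.sig
    · have : x ∈ (D' i).sig ∩ (D' j).sig := ⟨hB_init i x hx.1 hxi, hB_init j x hx.2 hxi⟩
      rw [hdec.inter i j hij] at this
      exact hΔ ▸ Or.inl (Or.inr this)
    · obtain ⟨h | ⟨F, rfl, hF⟩, h' | ⟨F', rfl, hF'⟩⟩ := hx
      · exact absurd (hinit _ h) hxi
      · exact absurd (hinit _ h) hxi
      · exact absurd (hinit _ h') hxi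
      -- A single group aligns with a single component, so fluents of different components have
      -- axioms in different groups, and condition 1 applies.
      · have hg : grp F ≠ grp F' := fun heq => hij (hcu F _ (hgrp_align F'
          ⟨heq ▸ hgrp F (D.flu_mem_nsig_ssaSentence F), hinit _ (hc F)⟩))
        rcases hss_sig _ _ hg ⟨hgrp F hF, hgrp F' hF'⟩ with h | rfl
        · exact hΔ ▸ Or.inl (Or.inl h)
        · exact absurd hF (Fm.doFn_notMem_nsig _)
  -- forgetting in the components
  set Ω : J → Set (GAtom L) := fun j =>
    {g ∈ D.omega α | Symb.flu g.flu ∈ (D' j).sig} with hΩ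
  have hΩ_fin : ∀ j, (Ω j).Finite := fun j =>
    D.omega_finite α (S := Symb.flu ⁻¹' (D' j).sig) ((Theory.sig_finite (hfin j)).preimage
      fun _ _ _ _ h => Symb.flu.inj h)
  have hT_nsig : ∀ j, ∀ φ ∈ D.inst α (Ω j) ∪ D' j, Fm.nsig φ ⊆ B j ∪ α.constants := by
    rintro j _ (⟨g, hg, rfl⟩ | hφ)
    · refine D.nsig_instSentence_subset α Set.subset_union_right
        (fun p => Or.inr (BAT.con_arg_mem_of_mem_omega hg.1 p)) fun x hx => Or.inl (Or.inr ?_)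
      exact ⟨g.flu, hcu _ _ hg.2, hx⟩
    · exact fun x hx => Or.inl (Or.inl (Theory.subset_sig hφ (Fm.nsig_subset_sig _ hx)))
  have hflu_const : ∀ F, Symb.flu F ∉ α.constants := fun F h => hΔ_flu F (hconst h)
  have hex : ∀ j, ∃ G : Theory L, G.UniformIn₂ .s0 α.sit ∧
      IsForget α (D.inst α (Ω j) ∪ D' j) (Ω j) G ∧ ∀ φ ∈ G, Fm.nsig φ ⊆ B j ∪ α.constants :=
    fun j => by
      refine exists_isForget (((hΩ_fin j).image _).union (hfin j)) ?_ (hΩ_fin j) (hT_nsig j)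
        fun g hg p => Or.inr (BAT.con_arg_mem_of_mem_omega hg.1 p)
      rintro _ (⟨g, -, rfl⟩ | hφ)
      · exact D.instSentence_uniform α g
      · exact (hunif j _ hφ).mono fun _ _ _ => Or.inl
  choose G hGU hGf hGn using hex
  have hGsig : ∀ j, ((G j).replace .s0 α.sit).sig ⊆ Δ ∪ B j := by
    intro j
    rw [Theory.sig_subset_iff]
    rintro _ ⟨φ, hφ, rfl⟩
    refine Fm.sig_replace_subset (hGU j φ hφ) (fun o a t ht => α.replace_eq_s0 ht)
      ((hGn j φ hφ).trans ?_) ?_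
    · exact Set.union_subset Set.subset_union_right (hconst.trans Set.subset_union_left)
    · rintro ⟨F, hF⟩
      have hFj := hB_flu j F ((hGn j φ hφ hF).resolve_right (hflu_const F))
      obtain ⟨ψ, hψ, hFψ⟩ := Set.mem_iUnion₂.1 hFj
      have hψU : ψ.Uniform fun _ _ t => t = .s0 := hunif j ψ hψ
      exact Or.inr (Or.inl (Theory.subset_sig hψ
        (hψU.s0_mem_sig (Fm.flu_mem_nsig_of_uniform hψU hFψ))))
  -- forgetting in the whole theory
  have hGU' : Theory.UniformIn₂ .s0 α.sit (⋃ j, G j) := fun φ hφ => by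
    obtain ⟨j, hj⟩ := Set.mem_iUnion.1 hφ
    exact hGU j φ hj
  have hGf' : IsForget α (D.inst α (D.omega α) ∪ D.init) (D.omega α) (⋃ j, G j) := by
    refine IsForget.of_equiv (IsForget.iUnion (T := fun j => D.inst α (Ω j) ∪ D' j) c ?_ ?_) ?_
    · intro j φ hφ F hF
      exact hcu F j (hB_flu j F ((hT_nsig j φ hφ hF).resolve_right (hflu_const F)))
    · intro j
      have : {g ∈ D.omega α | c g.flu = j} = Ω j := by
        ext g
        exact and_congr_right fun _ => ⟨fun h => h ▸ hc g.flu, hcu g.flu j⟩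
      rw [this]
      exact hGf j
    · intro Ob Ac Si _ _ _ M
      rw [SCStr.models_union, hdec.equiv Ob Ac Si M]
      simp only [SCStr.models_iUnion, SCStr.models_union, forall_and]
      refine and_congr_left fun _ => ?_
      simp only [D.models_inst]
      exact ⟨fun h g hg => h (c g.flu) g ⟨hg, hc g.flu⟩, fun h j g hg => h g hg.1⟩
  refine ⟨⟨_, BAT.exists_isLocalEffectProgression hGU' hGf'⟩, fun P hP =>
    ⟨hP.isProgression hD, ?_⟩⟩
  -- Both sides are updates of the initial theory along Ω, and the semantic description determines
  -- an update up to equivalence.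
  have hPequiv : ∀ (Ob Ac Si : Type) [Nonempty Ob] [Nonempty Ac] [Nonempty Si]
      (M : SCStr L Ob Ac Si), M.Models (P.replace .s0 α.sit) ↔
        ∀ j, M.Models ((G j).replace .s0 α.sit) := by
    intro Ob Ac Si _ _ _ M
    have hup : D.IsUpdate α D.init (D.omega α) (Theory.replace .s0 α.sit (⋃ j, G j)) :=
      ⟨_, hGU', hGf', fun _ _ _ _ _ _ _ => Iff.rfl⟩
    rw [hP.update.models_iff D.init_uniform, ← hup.models_iff D.init_uniform, Theory.replace,
      Set.image_iUnion, SCStr.models_iUnion]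
    rfl
  obtain ⟨j₀⟩ : Nonempty J := ⟨hdec.nontrivial.exists_pair_ne.choose⟩
  -- `P` is fixed only up to equivalence and may contain irrelevant symbols. Those outside Δ and
  -- every `B i` are all assigned to one arbitrary component `j₀`, so they are not shared.
  set X : J → Set (Symb L) := fun j =>
    Δ ∪ B j ∪ {x | j = j₀ ∧ x ∈ (P.replace .s0 α.sit).sig ∧ ∀ i, x ∉ Δ ∪ B i} with hX
  -- The tautologies make the signature exactly `X j`; in particular all of Δ occurs in every
  -- component, even where forgetting removed symbols.
  set D'' : J → Theory L := fun j => (G j).replace .s0 α.sit ∪ Symb.taut '' X j with hD''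
  have hD''_sig : ∀ j, (D'' j).sig = X j := fun j => by
    rw [hD'', Theory.sig_union, Symb.sig_image_taut]
    exact Set.union_eq_right.2 ((hGsig j).trans Set.subset_union_left)
  have hD''_up : ∀ j, D.IsUpdate α (D' j) (Ω j) (D'' j) := fun j => by
    refine ⟨G j, hGU j, hGf j, fun Ob Ac Si _ _ _ M => ?_⟩
    rw [hD'', SCStr.models_union]
    exact and_iff_left (Symb.models_taut _ M)
  refine ⟨Symb.taut '' (⋃ j, X j), D'', ?_, ?_, hD''_up, ?_⟩
  · rintro _ ⟨x, -, rfl⟩ Ob Ac Si _ _ _ M -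
    exact x.realize_taut M
  · refine ⟨hdec.nontrivial, fun i j hij => ?_, fun j => ?_, ?_, ?_⟩
    · rw [hD''_sig, hD''_sig]
      refine Set.Subset.antisymm ?_ fun x hx => ⟨Or.inl (Or.inl hx), Or.inl (Or.inl hx)⟩
      rintro x ⟨hi | ⟨rfl, -, hi⟩, hj | ⟨rfl, -, hj⟩⟩
      · rcases hi with hi | hi
        · exact hi
        rcases hj with hj | hj
        · exact hj
        exact hB_inter i j hij ⟨hi, hj⟩
      · exact absurd hi (hj i)
      · exact absurd hj (hi j)
      · exact absurd rfl hij
    · rw [hD''_sig]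
      obtain ⟨x, hx, hxΔ⟩ := hne j
      exact fun h => hxΔ (h ▸ Or.inl (Or.inr (Or.inl hx)))
    · rw [Theory.sig_union, Symb.sig_image_taut]
      simp only [hD''_sig]
      refine (Set.union_eq_right.2 fun x hx => Set.mem_iUnion.2 ?_).symm
      by_cases h : ∃ i, x ∈ Δ ∪ B i
      · obtain ⟨i, hi⟩ := h
        exact ⟨i, Or.inl hi⟩
      · exact ⟨j₀, Or.inr ⟨rfl, hx, not_exists.1 h⟩⟩
    · intro Ob Ac Si _ _ _ M
      rw [SCStr.models_union, hPequiv, SCStr.models_iUnion, and_iff_left (Symb.models_taut _ M)]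
      simp only [hD'', SCStr.models_union, and_iff_left (Symb.models_taut _ M)]
  · intro h i j hij
    rw [DeltaInseparable, (hD''_up i).cons_eq (hunif i) hΔ_flu,
      (hD''_up j).cons_eq (hunif j) hΔ_flu]
    exact h i j hij
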